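/- **Theorem (Cholesky-inverse-Wishart density).** Let $m$ be a natural number, $n>m-1$ a real number and $\Omega$ a real positive definite $m\times m$ matrix. For a positive definite matrix $X$, write $U_X$ for its upper Cholesky factor, the unique upper triangular matrix with positive diagonal entries such that $X=U_X^\top U_X$. For $\Sigma$ positive definite, let $W_m(n,\Sigma)$ be the Wishart distribution: if $n$ is an integer, the law of $ZZ^\top$ where $Z$ is an $m\times n$ matrix with independent $\mathcal N(0,\Sigma)$ columns; for arbitrary real $n>m-1$, the probability law whose density with respect to Lebesgue measure $\prod_{i\le j}da_{ij}$ on the positive definite matrices is proportional to $\exp(-\tfrac12\operatorname{tr}(\Sigma^{-1}A))\det(A)^{(n-m-1)/2}$ (the statement is asserted for each of the two descriptions). Let $\mathrm{IW}_m(n,\Omega)$ be the law of $A^{-1}$ for $A\sim W_m(n,\Omega^{-1})$. Then there is a constant $c>0$, depending only on $m$, $n$ and $\Omega$, such that for every random matrix $B\sim\mathrm{IW}_m(n,\Omega)$ the upper Cholesky factor $U_B$ exists almost surely, is a random matrix (measurable up to a null set), and its law has, with respect to Lebesgue measure $\prod_{i\le j}du_{ij}$ on the upper triangular matrices, the density $$p(U)=c\,\exp\!\Big(-\tfrac12\|U_\Omega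 U^{-1}\|_F^2\Big)\prod_{j=1}^m u_{jj}^{-(n+j)}$$ if all $u_{jj}>0$, and $p(U)=0$ otherwise. Here $\|X\|_F=\sqrt{\operatorname{tr}(X^\top X)}$. -/

import Mathlib

open MeasureTheory ProbabilityTheory
open scoped Matrix ENNReal

noncomputable section

/-- Real `m × m` matrices. -/
abbrev SqMat (m : ℕ) : Type := Matrix (Fin m) (Fin m) ℝ

/-- The Borel (= product) sigma-algebra on matrices. -/
instance SqMat.instMeasurableSpace (m : ℕ) : MeasurableSpace (SqMat m) :=
  inferInstanceAs (MeasurableSpace (Fin m → Fin m → ℝ))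

/-- `U` is an upper triangular matrix with positive diagonal entries. -/
def IsPosUpper {m : ℕ} (U : SqMat m) : Prop :=
  U.IsUpperTriangular ∧ ∀ j, 0 < U j j

/-- `U` is the upper Cholesky factor of `X`: it is upper triangular with positive diagonal entries
and `X = Uᵀ U`. (A positive definite `X` has exactly one such factor.) -/
def IsUpperCholesky {m : ℕ} (X U : SqMat m) : Prop :=
  IsPosUpper U ∧ X = Uᵀ * U

open Classical in
/-- The upper Cholesky factor of `X`, with the default value `0` if `X` has none. -/
def cholU {m : ℕ} (X : SqMat m) : SqMat m :=
  if h : ∃ U, IsUpperCholesky X U then h.choose else 0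

/-- The Frobenius norm `√(tr (Xᵀ X))`. -/
def frobNorm {m : ℕ} (X : SqMat m) : ℝ :=
  Real.sqrt (Xᵀ * X).trace

/-- Index set of the entries on and above the diagonal. -/
abbrev UpperIdx (m : ℕ) : Type := {p : Fin m × Fin m // p.1 ≤ p.2}

/-- The upper triangular matrix with prescribed entries on and above the diagonal. -/
def upperOfEntries {m : ℕ} (x : UpperIdx m → ℝ) : SqMat m :=
  Matrix.of fun i j => if h : i ≤ j then x ⟨(i, j), h⟩ else 0

/-- The symmetric matrix with prescribed entries on and above the diagonal. -/
def symmOfEntries {m : ℕ} (x : UpperIdx m → ℝ) : SqMat m :=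
  Matrix.of fun i j => if h : i ≤ j then x ⟨(i, j), h⟩ else x ⟨(j, i), (not_le.mp h).le⟩

/-- Lebesgue measure `∏_{i ≤ j} du_{ij}` on the upper triangular matrices, as a measure on all
matrices carried by the upper triangular ones. -/
def upperLebesgue (m : ℕ) : Measure (SqMat m) :=
  (volume : Measure (UpperIdx m → ℝ)).map upperOfEntries

/-- Lebesgue measure `∏_{i ≤ j} da_{ij}` on the symmetric matrices, as a measure on all matrices
carried by the symmetric ones. -/
def symmLebesgue (m : ℕ) : Measure (SqMat m) :=
  (volume : Measure (UpperIdx m → ℝ)).map symmOfEntries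

/-- The law of `Z Zᵀ`, where `Z` is an `m × k` random matrix whose columns are independent and
`N(0, S)`-distributed. A point `y` is the family of the columns of `Z`. -/
def gaussianWishart {m : ℕ} (k : ℕ) (S : SqMat m) : Measure (SqMat m) :=
  (Measure.pi fun _ : Fin k => multivariateGaussian (0 : EuclideanSpace ℝ (Fin m)) S).map
    fun y => (Matrix.of fun (i : Fin m) (l : Fin k) => y l i) *
      (Matrix.of fun (i : Fin m) (l : Fin k) => y l i)ᵀ

open Classical in
/-- The unnormalized Wishart density `exp (-tr (S⁻¹ A) / 2) * (det A) ^ ((n - m - 1) / 2)` at a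
positive definite `A`, extended by `0`. -/
def wishartKernel {m : ℕ} (n : ℝ) (S A : SqMat m) : ℝ :=
  if A.PosDef then
    Real.exp (-(1 / 2) * (S⁻¹ * A).trace) * A.det ^ ((n - (m : ℝ) - 1) / 2)
  else 0

/-- The measure with the unnormalized Wishart density. -/
def wishartUnnormalized {m : ℕ} (n : ℝ) (S : SqMat m) : Measure (SqMat m) :=
  (symmLebesgue m).withDensity fun A => ENNReal.ofReal (wishartKernel n S A)

/-- The Wishart law with real degrees of freedom `n`, given by its normalized density. -/
def densityWishart {m : ℕ} (n : ℝ) (S : SqMat m) : Measure (SqMat m) :=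
  (wishartUnnormalized n S Set.univ)⁻¹ • wishartUnnormalized n S

/-- `μ` is the Wishart law `W_m(n, S)`. For an integer number `n` of degrees of freedom this is the
law of `Z Zᵀ` with `n` independent `N(0, S)` columns; for an arbitrary real `n > m - 1` it is the
law with the Wishart density. Both descriptions are admitted. -/
def IsWishart {m : ℕ} (n : ℝ) (S : SqMat m) (μ : Measure (SqMat m)) : Prop :=
  (∃ k : ℕ, (k : ℝ) = n ∧ μ = gaussianWishart k S) ∨ μ = densityWishart n S

/-- `μ` is the inverse-Wishart law `IW_m(n, Ω)`: the law of `A⁻¹` for `A ∼ W_m(n, Ω⁻¹)`. -/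
def IsInverseWishart {m : ℕ} (n : ℝ) (Ω : SqMat m) (μ : Measure (SqMat m)) : Prop :=
  ∃ ν : Measure (SqMat m), IsWishart n Ω⁻¹ ν ∧ μ = ν.map fun A => A⁻¹

open Classical in
/-- `exp (-‖V U⁻¹‖² / 2) * ∏_j u_{jj} ^ (-(n + j))`, with `j` counted from `1`, at an upper
triangular `U` with positive diagonal entries, extended by `0`. -/
def cholInvWishartKernel {m : ℕ} (n : ℝ) (V U : SqMat m) : ℝ :=
  if IsPosUpper U then
    Real.exp (-(1 / 2) * frobNorm (V * U⁻¹) ^ 2) *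
      ∏ j : Fin m, U j j ^ (-(n + ((j : ℕ) + 1 : ℝ)))
  else 0

end

/-!
The upper triangular matrices with positive diagonal form a group `PosUpper m`, and `T ↦ T Tᵀ`
(`PosUpper.gram`) is a bijection from it onto the positive definite matrices: this is the existence
and uniqueness of the Cholesky factor. If `A = T Tᵀ`, then `A⁻¹ = Uᵀ U` with `U = T⁻¹`, so the upper
Cholesky factor of `A⁻¹` is `T⁻¹`. All measures in the theorem can thus be transported to the group,
where left translation by `g` is the action `A ↦ g A gᵀ` on positive definite matrices, the action
`Z ↦ g Z` on rectangular matrices `Z` with `A = Z Zᵀ`, and the action `U ↦ U g⁻¹` on the factor `U`.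

These actions are linear, and Lebesgue measure is relatively invariant under each of them, with a
multiplier that is the determinant of a triangular matrix (`PosUpper.map_leftAct`,
`PosUpper.map_rightAct`, `PosUpper.map_symmAct`, `map_colAct`). Dividing by the multiplier gives
left invariant measures on the group (`isMulLeftInvariant_comap_withDensity`): `haarLeft` and
`haarInv` from `dT` and `dU`, `haarSymm` from `dA`, and `haarScatter` from `dZ`. Left invariant
σ-finite measures are proportional, so no Jacobian of a nonlinear map is needed. Relative to each
of these measures, the Wishart law has, up to a constant factor, the density
`exp (-tr (Ω T Tᵀ) / 2) (det T) ^ n` (`PosUpper.weight`), in the Gaussian description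
(`PosUpper.gaussianWishart_eq_map`) as well as in the description by a density
(`PosUpper.wishartUnnormalized_eq_map`), and so has the measure with the density asserted for `U`
(`PosUpper.upperLebesgue_withDensity_eq_map`).

The total mass of this measure is finite: for `Ω = 1` and relative to `haarLeft` it is a product of
one-dimensional integrals, which converge because `n > m - 1`, and left invariance reduces
the general case to this one (`PosUpper.lintegral_weight_lt_top`). The constant `c` is the inverse
of the mass relative to `haarInv`; being probability measures, the two Wishart laws both agree with
the normalized measure.
-/

noncomputable section

/-! ### The group of upper triangular matrices with positive diagonal -/

namespace IsPosUpper

variable {m : ℕ} {A B : SqMat m}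

lemma det_eq (hA : IsPosUpper A) : A.det = ∏ j, A j j :=
  Matrix.det_of_isUpperTriangular hA.1

lemma det_pos (hA : IsPosUpper A) : 0 < A.det := by
  rw [hA.det_eq]
  exact Finset.prod_pos fun j _ => hA.2 j

lemma isUnit_det (hA : IsPosUpper A) : IsUnit A.det := hA.det_pos.ne'.isUnit

lemma one : IsPosUpper (1 : SqMat m) :=
  ⟨Matrix.blockTriangular_one, fun j => by simp⟩

lemma mul_apply_diag (hA : A.IsUpperTriangular) (hB : B.IsUpperTriangular) (j : Fin m) :
    (A * B) j j = A j j * B j j := by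
  rw [Matrix.mul_apply]
  refine Finset.sum_eq_single j (fun k _ hk => ?_) (by simp)
  rcases lt_or_gt_of_ne hk with h | h
  · rw [hA h, zero_mul]
  · rw [hB h, mul_zero]

lemma mul (hA : IsPosUpper A) (hB : IsPosUpper B) : IsPosUpper (A * B) :=
  ⟨hA.1.mul hB.1, fun j => by
    rw [mul_apply_diag hA.1 hB.1]
    exact mul_pos (hA.2 j) (hB.2 j)⟩

lemma inv_isUpperTriangular (hA : IsPosUpper A) : A⁻¹.IsUpperTriangular := by
  have := A.invertibleOfIsUnitDet hA.isUnit_det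
  exact Matrix.blockTriangular_inv_of_blockTriangular hA.1

lemma inv_apply_diag (hA : IsPosUpper A) (j : Fin m) : A⁻¹ j j = (A j j)⁻¹ := by
  have h := mul_apply_diag hA.1 hA.inv_isUpperTriangular j
  rw [Matrix.mul_nonsing_inv _ hA.isUnit_det, Matrix.one_apply_eq] at h
  exact eq_inv_of_mul_eq_one_right h.symm

lemma inv (hA : IsPosUpper A) : IsPosUpper A⁻¹ :=
  ⟨hA.inv_isUpperTriangular, fun j => by
    rw [hA.inv_apply_diag]
    exact inv_pos.2 (hA.2 j)⟩

/-- The only orthogonal matrix that is upper triangular with positive diagonal is the identity: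
its inverse is both upper and lower triangular. -/
lemma eq_one_of_mul_transpose (hA : IsPosUpper A) (h : A * Aᵀ = 1) : A = 1 := by
  have hinv : A⁻¹ = Aᵀ := Matrix.inv_eq_right_inv h
  have hoff : ∀ i j, i ≠ j → A i j = 0 := fun i j hij => by
    rcases lt_or_gt_of_ne hij with h' | h'
    · have := hA.inv_isUpperTriangular h'
      rwa [hinv] at this
    · exact hA.1 h'
  ext i j
  rcases eq_or_ne i j with rfl | hij
  · have h1 := hA.inv_apply_diag i
    rw [hinv, Matrix.transpose_apply] at h1
    have h2 := mul_inv_cancel₀ (hA.2 i).ne'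
    rw [← h1] at h2
    rw [Matrix.one_apply_eq]
    nlinarith [hA.2 i]
  · rw [hoff i j hij, Matrix.one_apply_ne hij]

end IsPosUpper

/-- The group of real upper triangular `m × m` matrices with positive diagonal entries. -/
def PosUpper (m : ℕ) : Type := {U : SqMat m // IsPosUpper U}

namespace PosUpper

variable {m : ℕ}

/-- The underlying matrix. -/
def val (T : PosUpper m) : SqMat m := Subtype.val T

/-- An upper triangular matrix with positive diagonal, as a group element. -/
def mk (U : SqMat m) (h : IsPosUpper U) : PosUpper m := ⟨U, h⟩

@[simp] lemma val_mk (U : SqMat m) (h : IsPosUpper U) : (mk U h).val = U := rfl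

lemma isPosUpper (T : PosUpper m) : IsPosUpper T.val := T.2

@[ext] lemma ext {S T : PosUpper m} (h : S.val = T.val) : S = T := Subtype.ext h

instance : Group (PosUpper m) where
  mul S T := ⟨S.val * T.val, S.isPosUpper.mul T.isPosUpper⟩
  one := ⟨1, IsPosUpper.one⟩
  inv T := ⟨T.val⁻¹, T.isPosUpper.inv⟩
  mul_assoc R S T := ext (Matrix.mul_assoc R.val S.val T.val)
  one_mul T := ext (Matrix.one_mul T.val)
  mul_one T := ext (Matrix.mul_one T.val)
  inv_mul_cancel T := ext (Matrix.nonsing_inv_mul T.val T.isPosUpper.isUnit_det)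

@[simp] lemma val_mul (S T : PosUpper m) : (S * T).val = S.val * T.val := rfl

@[simp] lemma val_one : (1 : PosUpper m).val = 1 := rfl

@[simp] lemma val_inv (T : PosUpper m) : T⁻¹.val = T.val⁻¹ := rfl

lemma diag_mul (S T : PosUpper m) (j : Fin m) :
    (S * T).val j j = S.val j j * T.val j j :=
  IsPosUpper.mul_apply_diag S.isPosUpper.1 T.isPosUpper.1 j

lemma diag_inv (T : PosUpper m) (j : Fin m) : T⁻¹.val j j = (T.val j j)⁻¹ :=
  T.isPosUpper.inv_apply_diag j

lemma diag_pos (T : PosUpper m) (j : Fin m) : 0 < T.val j j := T.isPosUpper.2 j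

lemma det_pos (T : PosUpper m) : 0 < T.val.det := T.isPosUpper.det_pos

lemma det_mul (S T : PosUpper m) : (S * T).val.det = S.val.det * T.val.det :=
  Matrix.det_mul _ _

/-- The positive definite matrix `T Tᵀ`. -/
def gram (T : PosUpper m) : SqMat m := T.val * T.valᵀ

lemma gram_mul (S T : PosUpper m) : (S * T).gram = S.val * T.gram * S.valᵀ := by
  simp [gram, Matrix.mul_assoc]

lemma gram_injective : Function.Injective (gram : PosUpper m → SqMat m) := by
  intro S T h
  have hu := T.isPosUpper.isUnit_det
  have hut : IsUnit T.valᵀ.det := by rwa [Matrix.det_transpose]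
  have h1 : (T⁻¹ * S).gram = 1 := by
    rw [gram_mul, h, gram, val_inv, Matrix.transpose_nonsing_inv, ← Matrix.mul_assoc,
      Matrix.nonsing_inv_mul _ hu, Matrix.one_mul, Matrix.mul_nonsing_inv _ hut]
  have h2 : T⁻¹ * S = 1 := ext ((T⁻¹ * S).isPosUpper.eq_one_of_mul_transpose h1)
  exact (inv_mul_eq_one.1 h2).symm

lemma gram_posDef (T : PosUpper m) : T.gram.PosDef := by
  have h := Matrix.PosDef.mul_conjTranspose_self T.val
    (Matrix.vecMul_injective_of_isUnit
      ((Matrix.isUnit_iff_isUnit_det _).2 T.isPosUpper.isUnit_det))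
  rwa [Matrix.conjTranspose_eq_transpose_of_trivial] at h

lemma gram_isSymm (T : PosUpper m) : T.gramᵀ = T.gram := by
  simp [gram, Matrix.transpose_mul]

lemma det_gram (T : PosUpper m) : T.gram.det = T.val.det ^ 2 := by
  rw [gram, Matrix.det_mul, Matrix.det_transpose, sq]

lemma gram_inv (T : PosUpper m) : T.gram⁻¹ = T⁻¹.valᵀ * T⁻¹.val := by
  rw [gram, Matrix.mul_inv_rev, val_inv, Matrix.transpose_nonsing_inv]

end PosUpper

/-- Existence of the upper Cholesky factor, from the LDL decomposition. -/
lemma Matrix.PosDef.exists_posUpper {m : ℕ} {X : SqMat m} (hX : X.PosDef) :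
    ∃ U : PosUpper m, X = U.valᵀ * U.val := by
  have hd : ∀ i, 0 < LDL.diagEntries hX i := fun i => by
    have hne : star (LDL.lowerInv hX i) ≠ 0 := by
      intro h0
      have h0' : LDL.lowerInv hX i = 0 := by simpa using h0
      have hdet : (LDL.lowerInv hX).det = 0 :=
        Matrix.det_eq_zero_of_row_eq_zero i fun j => congrFun h0' j
      exact (Matrix.isUnit_det_of_invertible (LDL.lowerInv hX)).ne_zero hdet
    have := hX.dotProduct_mulVec_pos hne
    rw [LDL.diagEntries, EuclideanSpace.inner_toLp_toLp, dotProduct_comm]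
    simpa using this
  have hlow : (LDL.lower hX)ᵀ.IsUpperTriangular := by
    have h1 : (LDL.lowerInv hX)ᵀ.IsUpperTriangular := fun i j hij =>
      LDL.lowerInv_triangular hX hij
    have : Invertible (LDL.lowerInv hX)ᵀ := Matrix.invertibleTranspose _
    have h2 := Matrix.blockTriangular_inv_of_blockTriangular h1
    rwa [← Matrix.transpose_nonsing_inv] at h2
  have hldet : (LDL.lower hX)ᵀ.det ≠ 0 := by
    rw [Matrix.det_transpose, LDL.lower]
    exact (Matrix.isUnit_nonsing_inv_det _
      (Matrix.isUnit_det_of_invertible (LDL.lowerInv hX))).ne_zero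
  have hdiag : ∀ i, LDL.lower hX i i ≠ 0 := fun i h0 => hldet <| by
    rw [Matrix.det_of_isUpperTriangular hlow]
    exact Finset.prod_eq_zero (Finset.mem_univ i) h0
  -- The rows of `D^{1/2} Lᵀ` are multiplied by signs that make the diagonal positive.
  let e : Fin m → ℝ := fun i => SignType.sign (LDL.lower hX i i) * √(LDL.diagEntries hX i)
  have he2 : ∀ i, e i * e i = LDL.diagEntries hX i := fun i => by
    have h1 : ((SignType.sign (LDL.lower hX i i) : SignType) : ℝ) *
        (SignType.sign (LDL.lower hX i i) : SignType) = 1 := by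
      rcases lt_or_gt_of_ne (hdiag i) with h | h
      · simp [sign_neg h]
      · simp [sign_pos h]
    have h2 := Real.mul_self_sqrt (hd i).le
    simp only [e]
    linear_combination h2 + (√(LDL.diagEntries hX i)) ^ 2 * h1
  have hU : IsPosUpper (Matrix.diagonal e * (LDL.lower hX)ᵀ) := by
    refine ⟨(Matrix.blockTriangular_diagonal e).mul hlow, fun i => ?_⟩
    rw [Matrix.diagonal_mul, Matrix.transpose_apply]
    have := Real.sqrt_pos.2 (hd i)
    simp only [e]
    rcases lt_or_gt_of_ne (hdiag i) with h | h
    · simp only [sign_neg h]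
      simp
      nlinarith
    · simp only [sign_pos h]
      simp
      positivity
  refine ⟨PosUpper.mk _ hU, ?_⟩
  rw [PosUpper.val_mk, Matrix.transpose_mul, Matrix.transpose_transpose,
    Matrix.diagonal_transpose, Matrix.mul_assoc, ← Matrix.mul_assoc (Matrix.diagonal e),
    Matrix.diagonal_mul_diagonal]
  have h := LDL.lower_conj_diag hX
  rw [Matrix.conjTranspose_eq_transpose_of_trivial, Matrix.mul_assoc] at h
  simp only [he2]
  exact h.symm

namespace PosUpper

variable {m : ℕ}

lemma range_gram : Set.range (gram : PosUpper m → SqMat m) = {X | X.PosDef} := by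
  ext X
  refine ⟨fun ⟨T, hT⟩ => hT ▸ T.gram_posDef, fun hX => ?_⟩
  obtain ⟨U, hU⟩ := (Matrix.PosDef.inv hX).exists_posUpper
  refine ⟨U⁻¹, ?_⟩
  have hdet : IsUnit X.det := (Matrix.isUnit_iff_isUnit_det _).1 (Matrix.PosDef.isUnit hX)
  have h : (U⁻¹).gram⁻¹ = X⁻¹ := by rw [gram_inv, inv_inv, hU]
  rw [← Matrix.nonsing_inv_nonsing_inv X hdet, ← h, Matrix.nonsing_inv_nonsing_inv]
  exact (Matrix.isUnit_iff_isUnit_det _).1 (gram_posDef _).isUnit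

/-- Uniqueness of the upper Cholesky factor. -/
lemma eq_of_transpose_mul_self {S T : PosUpper m} (h : S.valᵀ * S.val = T.valᵀ * T.val) :
    S = T := by
  have h1 : S⁻¹.gram⁻¹ = T⁻¹.gram⁻¹ := by rw [gram_inv, gram_inv, inv_inv, inv_inv, h]
  have hu : ∀ R : PosUpper m, IsUnit R.gram.det := fun R =>
    (Matrix.isUnit_iff_isUnit_det _).1 R.gram_posDef.isUnit
  have h2 : S⁻¹.gram = T⁻¹.gram := by
    rw [← Matrix.nonsing_inv_nonsing_inv _ (hu S⁻¹), h1, Matrix.nonsing_inv_nonsing_inv _ (hu T⁻¹)]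
  exact inv_injective (gram_injective h2)

lemma cholU_transpose_mul_self (T : PosUpper m) : cholU (T.valᵀ * T.val) = T.val := by
  have h : ∃ U, IsUpperCholesky (T.valᵀ * T.val) U := ⟨T.val, T.isPosUpper, rfl⟩
  rw [cholU, dif_pos h]
  have hs := h.choose_spec
  have := eq_of_transpose_mul_self (S := mk h.choose hs.1) (T := T) hs.2.symm
  exact congrArg PosUpper.val this

end PosUpper

lemma Matrix.PosDef.isUpperCholesky_cholU {m : ℕ} {X : SqMat m} (hX : X.PosDef) :
    IsUpperCholesky X (cholU X) := by
  obtain ⟨U, rfl⟩ := hX.exists_posUpper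
  rw [U.cholU_transpose_mul_self]
  exact ⟨U.isPosUpper, rfl⟩

/-! ### Measurability on matrices and on the triangular group -/

instance SqMat.instBorelSpace (m : ℕ) : BorelSpace (SqMat m) :=
  inferInstanceAs (BorelSpace (Fin m → Fin m → ℝ))

instance SqMat.instStandardBorelSpace (m : ℕ) : StandardBorelSpace (SqMat m) :=
  inferInstanceAs (StandardBorelSpace (Fin m → Fin m → ℝ))

instance SqMat.instSecondCountableTopology (m : ℕ) : SecondCountableTopology (SqMat m) :=
  inferInstanceAs (SecondCountableTopology (Fin m → Fin m → ℝ))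

namespace SqMat

variable {m : ℕ}

lemma measurable_of_entries {α : Type*} [MeasurableSpace α] {f : α → SqMat m}
    (h : ∀ i j, Measurable fun a => f a i j) : Measurable f :=
  measurable_pi_iff.2 fun i => measurable_pi_iff.2 (h i)

lemma measurable_entry (i j : Fin m) : Measurable fun A : SqMat m => A i j :=
  (measurable_pi_apply j).comp (measurable_pi_apply (X := fun _ : Fin m => Fin m → ℝ) i)

lemma measurable_det : Measurable fun A : SqMat m => A.det :=
  (continuous_id.matrix_det).measurable

lemma measurable_inv : Measurable fun A : SqMat m => A⁻¹ := by
  refine measurable_of_entries fun i j => ?_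
  have h : ∀ A : SqMat m, A⁻¹ i j = A.det⁻¹ * A.adjugate i j := fun A => by
    rw [Matrix.inv_def, Ring.inverse_eq_inv', Matrix.smul_apply, smul_eq_mul]
  simp only [h]
  exact measurable_det.inv.mul
    ((measurable_entry i j).comp (continuous_id.matrix_adjugate).measurable)

lemma measurable_frobNorm : Measurable (frobNorm : SqMat m → ℝ) :=
  Real.continuous_sqrt.measurable.comp
    ((continuous_id.matrix_transpose.matrix_mul continuous_id).matrix_trace).measurable

/-- The entries on and above the diagonal. -/
def entries (A : SqMat m) : UpperIdx m → ℝ := fun p => A p.1.1 p.1.2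

lemma measurable_entries : Measurable (entries : SqMat m → UpperIdx m → ℝ) :=
  measurable_pi_iff.2 fun _ => measurable_entry _ _

lemma upperOfEntries_entries {A : SqMat m} (hA : A.IsUpperTriangular) :
    upperOfEntries (entries A) = A := by
  ext i j
  by_cases h : i ≤ j
  · simp [upperOfEntries, entries, h]
  · simp [upperOfEntries, h, hA (not_le.1 h)]

lemma entries_upperOfEntries (x : UpperIdx m → ℝ) : entries (upperOfEntries x) = x := by
  ext p
  simp [upperOfEntries, entries, p.2]

lemma upperOfEntries_isUpperTriangular (x : UpperIdx m → ℝ) :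
    (upperOfEntries x).IsUpperTriangular := fun i j h => by
  have h' : ¬ i ≤ j := not_le.2 h
  simp [upperOfEntries, h']

lemma symmOfEntries_entries {A : SqMat m} (hA : Aᵀ = A) : symmOfEntries (entries A) = A := by
  ext i j
  by_cases h : i ≤ j
  · simp [symmOfEntries, entries, h]
  · simp only [symmOfEntries, entries, h, Matrix.of_apply, dite_false]
    exact congrFun (congrFun hA i) j

lemma entries_symmOfEntries (x : UpperIdx m → ℝ) : entries (symmOfEntries x) = x := by
  ext p
  simp [symmOfEntries, entries, p.2]

lemma symmOfEntries_transpose (x : UpperIdx m → ℝ) :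
    (symmOfEntries x)ᵀ = symmOfEntries x := by
  ext i j
  rcases lt_trichotomy i j with h | rfl | h
  · simp [symmOfEntries, h.le, h.not_ge]
  · simp
  · simp [symmOfEntries, h.le, h.not_ge]

lemma measurable_upperOfEntries : Measurable (upperOfEntries : (UpperIdx m → ℝ) → SqMat m) := by
  refine measurable_of_entries fun i j => ?_
  by_cases h : i ≤ j
  · simpa [upperOfEntries, h] using measurable_pi_apply _
  · simp [upperOfEntries, h]

lemma measurable_symmOfEntries : Measurable (symmOfEntries : (UpperIdx m → ℝ) → SqMat m) := by
  refine measurable_of_entries fun i j => ?_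
  by_cases h : i ≤ j
  · simpa [symmOfEntries, h] using measurable_pi_apply _
  · simpa [symmOfEntries, h] using measurable_pi_apply _

lemma measurableSet_isPosUpper : MeasurableSet {U : SqMat m | IsPosUpper U} := by
  have h : {U : SqMat m | IsPosUpper U} =
      (⋂ i, ⋂ j, ⋂ (_ : j < i), {U : SqMat m | U i j = 0}) ∩ ⋂ j, {U : SqMat m | 0 < U j j} := by
    ext U
    simp only [IsPosUpper, Matrix.BlockTriangular, id, Set.mem_inter_iff, Set.mem_iInter,
      Set.mem_ofPred_eq]
  rw [h]
  refine MeasurableSet.inter ?_ ?_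
  · exact .iInter fun i => .iInter fun j => .iInter fun _ =>
      measurable_entry i j (measurableSet_singleton 0)
  · exact .iInter fun j => measurableSet_lt measurable_const (measurable_entry j j)

end SqMat

namespace PosUpper

variable {m : ℕ}

instance : MeasurableSpace (PosUpper m) :=
  inferInstanceAs (MeasurableSpace {U : SqMat m // IsPosUpper U})

instance : StandardBorelSpace (PosUpper m) :=
  SqMat.measurableSet_isPosUpper.standardBorel

lemma measurableEmbedding_val : MeasurableEmbedding (val : PosUpper m → SqMat m) :=
  MeasurableEmbedding.subtype_coe SqMat.measurableSet_isPosUpper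

lemma measurable_val : Measurable (val : PosUpper m → SqMat m) :=
  measurableEmbedding_val.measurable

lemma measurable_val_apply (i j : Fin m) : Measurable fun T : PosUpper m => T.val i j :=
  (SqMat.measurable_entry i j).comp measurable_val

instance : MeasurableMul₂ (PosUpper m) where
  measurable_mul := by
    refine measurableEmbedding_val.measurable_comp_iff.1 (SqMat.measurable_of_entries fun i j => ?_)
    simp only [Function.comp_apply, val_mul, Matrix.mul_apply]
    exact Finset.measurable_sum _ fun k _ =>
      ((measurable_val_apply i k).comp measurable_fst).mul
        ((measurable_val_apply k j).comp measurable_snd)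

instance : MeasurableInv (PosUpper m) where
  measurable_inv :=
    measurableEmbedding_val.measurable_comp_iff.1 (SqMat.measurable_inv.comp measurable_val)

lemma measurable_gram : Measurable (gram : PosUpper m → SqMat m) := by
  refine SqMat.measurable_of_entries fun i j => ?_
  simp only [gram, Matrix.mul_apply, Matrix.transpose_apply]
  exact Finset.measurable_sum _ fun k _ => (measurable_val_apply i k).mul (measurable_val_apply j k)

lemma measurableEmbedding_gram : MeasurableEmbedding (gram : PosUpper m → SqMat m) :=
  measurable_gram.measurableEmbedding gram_injective

/-- Coordinates of the triangular group: the entries of `T` on and above the diagonal. -/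
def coord (T : PosUpper m) : UpperIdx m → ℝ := SqMat.entries T.val

/-- The coordinates of the inverse. -/
def coordInv (T : PosUpper m) : UpperIdx m → ℝ := coord T⁻¹

/-- The coordinates of the symmetric matrix `T Tᵀ`. -/
def coordGram (T : PosUpper m) : UpperIdx m → ℝ := SqMat.entries T.gram

lemma upperOfEntries_coord (T : PosUpper m) : upperOfEntries T.coord = T.val :=
  SqMat.upperOfEntries_entries T.isPosUpper.1

lemma symmOfEntries_coordGram (T : PosUpper m) : symmOfEntries T.coordGram = T.gram :=
  SqMat.symmOfEntries_entries T.gram_isSymm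

lemma coord_injective : Function.Injective (coord : PosUpper m → UpperIdx m → ℝ) := fun S T h =>
  ext (by rw [← upperOfEntries_coord, h, upperOfEntries_coord])

lemma measurableEmbedding_coord : MeasurableEmbedding (coord : PosUpper m → UpperIdx m → ℝ) :=
  (SqMat.measurable_entries.comp measurable_val).measurableEmbedding coord_injective

lemma measurableEmbedding_coordInv :
    MeasurableEmbedding (coordInv : PosUpper m → UpperIdx m → ℝ) :=
  (measurableEmbedding_coord.measurable.comp measurable_inv).measurableEmbedding
    (coord_injective.comp inv_injective)

lemma measurableEmbedding_coordGram :
    MeasurableEmbedding (coordGram : PosUpper m → UpperIdx m → ℝ) :=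
  (SqMat.measurable_entries.comp measurable_gram).measurableEmbedding fun S T h =>
    gram_injective (by
      rw [← symmOfEntries_coordGram, ← symmOfEntries_coordGram]
      exact congrArg symmOfEntries h)

lemma range_coord :
    Set.range (coord : PosUpper m → UpperIdx m → ℝ) = {x | ∀ j, 0 < x ⟨(j, j), le_rfl⟩} := by
  ext x
  refine ⟨?_, fun hx => ?_⟩
  · rintro ⟨T, rfl⟩ j
    exact T.diag_pos j
  · have hU : IsPosUpper (upperOfEntries x) :=
      ⟨SqMat.upperOfEntries_isUpperTriangular x, fun j => by simpa [upperOfEntries] using hx j⟩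
    exact ⟨mk _ hU, by rw [coord, val_mk, SqMat.entries_upperOfEntries]⟩

lemma range_coordInv : Set.range (coordInv : PosUpper m → UpperIdx m → ℝ) = Set.range coord :=
  (Equiv.inv (PosUpper m)).surjective.range_comp coord

lemma range_coordGram :
    Set.range (coordGram : PosUpper m → UpperIdx m → ℝ) = {x | (symmOfEntries x).PosDef} := by
  ext x
  refine ⟨?_, fun hx => ?_⟩
  · rintro ⟨T, rfl⟩
    rw [Set.mem_ofPred_eq, symmOfEntries_coordGram]
    exact T.gram_posDef
  · obtain ⟨T, hT⟩ : symmOfEntries x ∈ Set.range (gram : PosUpper m → SqMat m) := by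
      rw [range_gram]; exact hx
    exact ⟨T, by rw [coordGram, hT, SqMat.entries_symmOfEntries]⟩

end PosUpper

lemma measurableSet_posDef {m : ℕ} : MeasurableSet {X : SqMat m | X.PosDef} := by
  rw [← PosUpper.range_gram]
  exact PosUpper.measurableEmbedding_gram.measurableSet_range

lemma measurable_cholU {m : ℕ} : Measurable (cholU : SqMat m → SqMat m) := by
  let f : PosUpper m → SqMat m := fun T => T.valᵀ * T.val
  have hf : MeasurableEmbedding f := by
    refine Measurable.measurableEmbedding ?_ fun S T h => PosUpper.eq_of_transpose_mul_self h
    refine SqMat.measurable_of_entries fun i j => ?_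
    simp only [f, Matrix.mul_apply, Matrix.transpose_apply]
    exact Finset.measurable_sum _ fun k _ =>
      (PosUpper.measurable_val_apply k i).mul (PosUpper.measurable_val_apply k j)
  have h : (cholU : SqMat m → SqMat m) = Function.extend f PosUpper.val fun _ => 0 := by
    ext1 X
    by_cases hX : ∃ T, f T = X
    · obtain ⟨T, rfl⟩ := hX
      rw [hf.injective.extend_apply]
      exact T.cholU_transpose_mul_self
    · rw [Function.extend_apply' _ _ _ hX, cholU, dif_neg]
      rintro ⟨U, hU⟩
      exact hX ⟨PosUpper.mk U hU.1, hU.2.symm⟩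
  rw [h]
  exact hf.measurable_extend PosUpper.measurable_val measurable_const

/-! ### Invariant measures from relatively invariant ones -/

section Invariant

variable {G X : Type*} [Group G] [MeasurableSpace G] [MeasurableSpace X]

/-- Let `G` act on `X` through `Φ`, let `q : G → X` be an equivariant embedding of `G` with its left
translations, and let `μ` be relatively invariant with multiplier `χ`. Then the pullback of `μ` to
`G`, with density `χ⁻¹`, is left invariant. -/
theorem isMulLeftInvariant_comap_withDensity [MeasurableMul G] {q : G → X}
    (hq : MeasurableEmbedding q) {Φ : G → X → X} (hΦm : ∀ g, Measurable (Φ g))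
    (hΦq : ∀ g t, Φ g (q t) = q (g * t)) (hΦi : ∀ g x, Φ g⁻¹ (Φ g x) = x)
    {χ : G → ℝ} (hχm : Measurable χ) (hχ0 : ∀ g, 0 < χ g) (hχ : ∀ g h, χ (g * h) = χ g * χ h)
    {μ : Measure X} (hμ : ∀ g, μ.map (Φ g) = ENNReal.ofReal (χ g)⁻¹ • μ) :
    ((μ.comap q).withDensity fun t => ENNReal.ofReal (χ t)⁻¹).IsMulLeftInvariant := by
  refine ⟨fun g => ?_⟩
  have hg : Measurable fun t : G => g * t := measurable_const_mul g
  have h1 : (μ.comap q).map (g * ·) = ENNReal.ofReal (χ g)⁻¹ • μ.comap q := by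
    ext s hs
    rw [Measure.map_apply hg hs, Measure.smul_apply, hq.comap_apply, hq.comap_apply,
      ← Measure.smul_apply, ← hμ, Measure.map_apply (hΦm g) (hq.measurableSet_image.2 hs)]
    congr 1
    ext x
    constructor
    · rintro ⟨t, ht, rfl⟩
      exact ⟨g * t, ht, (hΦq g t).symm⟩
    · rintro ⟨t, ht, hx⟩
      refine ⟨g⁻¹ * t, by simpa using ht, ?_⟩
      rw [← hΦq, hx, hΦi]
  have hw : Measurable fun t => ENNReal.ofReal (χ t)⁻¹ := hχm.inv.ennreal_ofReal
  ext s hs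
  rw [Measure.map_apply hg hs, withDensity_apply _ (hg hs), withDensity_apply _ hs]
  have h2 : ∀ t, ENNReal.ofReal (χ t)⁻¹ =
      ENNReal.ofReal (χ g) * ENNReal.ofReal (χ (g * t))⁻¹ := fun t => by
    rw [← ENNReal.ofReal_mul (hχ0 g).le, hχ, mul_inv, ← mul_assoc,
      mul_inv_cancel₀ (hχ0 g).ne', one_mul]
  calc ∫⁻ t in (g * ·) ⁻¹' s, ENNReal.ofReal (χ t)⁻¹ ∂μ.comap q
      = ∫⁻ t in (g * ·) ⁻¹' s, ENNReal.ofReal (χ g) * ENNReal.ofReal (χ (g * t))⁻¹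
          ∂μ.comap q := lintegral_congr fun t => h2 t
    _ = ∫⁻ t in s, ENNReal.ofReal (χ g) * ENNReal.ofReal (χ t)⁻¹ ∂(μ.comap q).map (g * ·) :=
        (setLIntegral_map hs (hw.const_mul _) hg).symm
    _ = ∫⁻ t in s, ENNReal.ofReal (χ t)⁻¹ ∂μ.comap q := by
        rw [h1, Measure.restrict_smul, lintegral_smul_measure, lintegral_const_mul _ hw,
          smul_eq_mul, ← mul_assoc, ← ENNReal.ofReal_mul (inv_pos.2 (hχ0 g)).le,
          inv_mul_cancel₀ (hχ0 g).ne', ENNReal.ofReal_one, one_mul]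

lemma exists_measure_ne_zero_ne_top {α : Type*} [MeasurableSpace α] (ν : Measure α) [SigmaFinite ν]
    (hν : ν ≠ 0) : ∃ s, ν s ≠ 0 ∧ ν s ≠ ∞ := by
  by_contra! h
  refine hν (Measure.measure_univ_eq_zero.1 ?_)
  rw [← iUnion_spanningSets ν]
  refine measure_iUnion_null fun i => ?_
  by_contra h0
  exact (measure_spanningSets_lt_top ν i).ne (h _ h0)

variable [MeasurableMul₂ G] [MeasurableInv G]

/-- Uniqueness of left invariant measures, up to a factor in `[0, ∞]`. -/
theorem exists_eq_smul_of_isMulLeftInvariant (μ ν : Measure G) [SigmaFinite μ] [SigmaFinite ν]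
    [μ.IsMulLeftInvariant] [ν.IsMulLeftInvariant] (hν : ν ≠ 0) : ∃ a : ℝ≥0∞, μ = a • ν := by
  obtain ⟨s, h0, h1⟩ := exists_measure_ne_zero_ne_top ν hν
  exact ⟨_, measure_eq_div_smul μ ν h0 h1⟩

/-- Uniqueness of left invariant measures, up to a factor in `(0, ∞)`. -/
theorem exists_eq_smul_of_isMulLeftInvariant' (μ ν : Measure G) [SigmaFinite μ] [SigmaFinite ν]
    [μ.IsMulLeftInvariant] [ν.IsMulLeftInvariant] (hμ : μ ≠ 0) (hν : ν ≠ 0) :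
    ∃ a : ℝ≥0∞, a ≠ 0 ∧ a ≠ ∞ ∧ μ = a • ν := by
  obtain ⟨a, ha⟩ := exists_eq_smul_of_isMulLeftInvariant μ ν hν
  refine ⟨a, ?_, ?_, ha⟩
  · rintro rfl
    exact hμ (by simpa using ha)
  · rintro rfl
    obtain ⟨s, h0, h1⟩ := exists_measure_ne_zero_ne_top μ hμ
    rw [ha, Measure.smul_apply, smul_eq_mul] at h0 h1
    exact h1 (ENNReal.top_mul fun h => h0 (by rw [h, mul_zero]))

end Invariant

section Comap

variable {α β : Type*} [MeasurableSpace α] [MeasurableSpace β]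

lemma MeasurableEmbedding.sigmaFinite_comap {f : α → β} (hf : MeasurableEmbedding f)
    (μ : Measure β) [SigmaFinite μ] : SigmaFinite (μ.comap f) := by
  refine SigmaFinite.of_map _ hf.measurable.aemeasurable ?_
  rw [hf.map_comap]
  infer_instance

/-- A measure whose density vanishes outside the range of an embedding is the image of its
pullback. -/
lemma MeasurableEmbedding.map_comap_withDensity {f : α → β} (hf : MeasurableEmbedding f)
    (μ : Measure β) {k : β → ℝ≥0∞} (hk : Measurable k) (h0 : ∀ᵐ x ∂μ, x ∉ Set.range f → k x = 0) :
    ((μ.comap f).withDensity (k ∘ f)).map f = μ.withDensity k := by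
  ext s hs
  rw [Measure.map_apply hf.measurable hs, withDensity_apply _ (hf.measurable hs),
    withDensity_apply _ hs]
  change ∫⁻ a in f ⁻¹' s, k (f a) ∂μ.comap f = _
  rw [← setLIntegral_map hs hk hf.measurable, hf.map_comap,
    Measure.restrict_restrict hs]
  rw [← lintegral_indicator hs, ← lintegral_indicator (hs.inter hf.measurableSet_range)]
  refine lintegral_congr_ae (h0.mono fun x hx => ?_)
  by_cases hxs : x ∈ s <;> by_cases hxr : x ∈ Set.range f <;> simp [hxs, hxr]
  exact (hx hxr).symm

lemma withDensity_comp_map {f : α → β} (hf : Measurable f) (μ : Measure α) {k : β → ℝ≥0∞}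
    (hk : Measurable k) : (μ.withDensity (k ∘ f)).map f = (μ.map f).withDensity k := by
  ext s hs
  rw [Measure.map_apply hf hs, withDensity_apply _ (hf hs), withDensity_apply _ hs,
    setLIntegral_map hs hk hf]
  rfl

end Comap

/-! ### Linear actions of the triangular group on triangular and symmetric matrices -/

namespace SqMat

variable {m : ℕ}

/-- `SqMat.entries` as a linear map. -/
def entriesₗ (m : ℕ) : SqMat m →ₗ[ℝ] UpperIdx m → ℝ where
  toFun := entries
  map_add' _ _ := rfl
  map_smul' _ _ := rfl

/-- `upperOfEntries` as a linear map. -/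
def upperₗ (m : ℕ) : (UpperIdx m → ℝ) →ₗ[ℝ] SqMat m where
  toFun := upperOfEntries
  map_add' x y := by
    ext i j
    by_cases h : i ≤ j <;> simp [upperOfEntries, h]
  map_smul' c x := by
    ext i j
    by_cases h : i ≤ j <;> simp [upperOfEntries, h]

/-- `symmOfEntries` as a linear map. -/
def symmₗ (m : ℕ) : (UpperIdx m → ℝ) →ₗ[ℝ] SqMat m where
  toFun := symmOfEntries
  map_add' x y := by
    ext i j
    by_cases h : i ≤ j <;> simp [symmOfEntries, h]
  map_smul' c x := by
    ext i j
    by_cases h : i ≤ j <;> simp [symmOfEntries, h]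

lemma upperOfEntries_single (q : UpperIdx m) :
    upperOfEntries (Pi.single q 1) = Matrix.single q.1.1 q.1.2 1 := by
  obtain ⟨⟨a, b⟩, hab⟩ := q
  ext i j
  by_cases h : i ≤ j
  · simp [upperOfEntries, h, Pi.single_apply, Matrix.single_apply, eq_comm]
  · have : ¬ (a = i ∧ b = j) := fun h' => h (h'.1 ▸ h'.2 ▸ hab)
    simp [upperOfEntries, h, this]

lemma symmOfEntries_single (q : UpperIdx m) :
    symmOfEntries (Pi.single q 1) =
      Matrix.single q.1.1 q.1.2 1 + if q.1.1 = q.1.2 then 0 else Matrix.single q.1.2 q.1.1 1 := by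
  obtain ⟨⟨a, b⟩, hab⟩ := q
  have hab' : a ≤ b := hab
  ext i j
  by_cases h : i ≤ j <;> by_cases h' : a = b <;>
    simp [symmOfEntries, h, h', Pi.single_apply, Matrix.single_apply] <;> grind

/-- A linear map on the coordinates that is triangular with positive diagonal, with respect to some
linear order of the coordinates, rescales Lebesgue measure by the product of its diagonal. -/
lemma map_volume_of_triangular {α : Type*} [LinearOrder α] {b : UpperIdx m → α}
    (hb : Function.Injective b) (f : (UpperIdx m → ℝ) →ₗ[ℝ] UpperIdx m → ℝ) {d : UpperIdx m → ℝ}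
    (hd : ∀ p, 0 < d p) (h : ∀ p q, b q < b p → f (Pi.single q 1) p = 0)
    (hdiag : ∀ p, f (Pi.single p 1) p = d p) :
    (volume : Measure (UpperIdx m → ℝ)).map f = ENNReal.ofReal (∏ p, d p)⁻¹ • volume := by
  have hM : ∀ p q, LinearMap.toMatrix' f p q = f (Pi.single q 1) p := fun p q =>
    LinearMap.toMatrix'_apply f p q
  have hbt : ((LinearMap.toMatrix' f).BlockTriangular b) := fun p q hpq => by
    rw [hM]; exact h p q hpq
  have hdet : LinearMap.det f = ∏ p, d p := by
    rw [← LinearMap.det_toMatrix', hbt.det]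
    have hsq : ∀ p : UpperIdx m, ((LinearMap.toMatrix' f).toSquareBlock b (b p)).det = d p :=
      fun p => by
        have : Unique {i // b i = b p} := ⟨⟨p, rfl⟩, fun i => Subtype.ext (hb i.2)⟩
        rw [Matrix.det_unique, ← hdiag p, ← hM]
        have h2 : (default : {i // b i = b p}) = ⟨p, rfl⟩ := Subsingleton.elim _ _
        rw [h2]
        rfl
    rw [Finset.prod_image fun p _ q _ hpq => hb hpq]
    exact Finset.prod_congr rfl fun p _ => hsq p
  have hpos : 0 < ∏ p, d p := Finset.prod_pos fun p _ => hd p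
  rw [Real.map_linearMap_volume_pi_eq_smul_volume_pi (by rw [hdet]; exact hpos.ne'), hdet,
    abs_of_pos (inv_pos.2 hpos)]

/-- The lexicographic order of the coordinates. -/
def lexIdx (p : UpperIdx m) : Fin m ×ₗ Fin m := toLex p.1

lemma lexIdx_injective : Function.Injective (lexIdx : UpperIdx m → Fin m ×ₗ Fin m) :=
  toLex.injective.comp Subtype.val_injective

lemma not_le_of_lexIdx_lt {p q : UpperIdx m} (h : lexIdx q < lexIdx p) :
    ¬ (p.1.1 ≤ q.1.1 ∧ p.1.2 ≤ q.1.2) := fun h' =>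
  absurd (Prod.Lex.toLex_mono (show (p : Fin m × Fin m) ≤ q from h')) (not_le.2 h)

end SqMat

namespace PosUpper

open SqMat

variable {m : ℕ}

/-- Left translation in coordinates. -/
def leftAct (g : PosUpper m) : (UpperIdx m → ℝ) →ₗ[ℝ] UpperIdx m → ℝ :=
  entriesₗ m ∘ₗ LinearMap.mulLeft ℝ g.val ∘ₗ upperₗ m

/-- Right translation by the inverse, in coordinates. -/
def rightAct (g : PosUpper m) : (UpperIdx m → ℝ) →ₗ[ℝ] UpperIdx m → ℝ :=
  entriesₗ m ∘ₗ LinearMap.mulRight ℝ g⁻¹.val ∘ₗ upperₗ m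

/-- The action `A ↦ g A gᵀ` on symmetric matrices, in coordinates. -/
def symmAct (g : PosUpper m) : (UpperIdx m → ℝ) →ₗ[ℝ] UpperIdx m → ℝ :=
  entriesₗ m ∘ₗ LinearMap.mulRight ℝ g.valᵀ ∘ₗ LinearMap.mulLeft ℝ g.val ∘ₗ symmₗ m

lemma leftAct_apply (g : PosUpper m) (x : UpperIdx m → ℝ) :
    leftAct g x = entries (g.val * upperOfEntries x) := rfl

lemma rightAct_apply (g : PosUpper m) (x : UpperIdx m → ℝ) :
    rightAct g x = entries (upperOfEntries x * g⁻¹.val) := rfl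

lemma symmAct_apply (g : PosUpper m) (x : UpperIdx m → ℝ) :
    symmAct g x = entries (g.val * symmOfEntries x * g.valᵀ) := rfl

lemma measurable_linearMap (f : (UpperIdx m → ℝ) →ₗ[ℝ] UpperIdx m → ℝ) : Measurable f :=
  (LinearMap.continuous_on_pi f).measurable

lemma inv_val_mul_val (g : PosUpper m) : g⁻¹.val * g.val = 1 := by
  rw [← val_mul, inv_mul_cancel, val_one]

lemma leftAct_coord (g T : PosUpper m) : leftAct g T.coord = (g * T).coord := by
  rw [leftAct_apply, upperOfEntries_coord, coord, val_mul]

lemma leftAct_inv_leftAct (g : PosUpper m) (x : UpperIdx m → ℝ) :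
    leftAct g⁻¹ (leftAct g x) = x := by
  rw [leftAct_apply, leftAct_apply, upperOfEntries_entries
    (g.isPosUpper.1.mul (upperOfEntries_isUpperTriangular x)), ← Matrix.mul_assoc,
    inv_val_mul_val, Matrix.one_mul, entries_upperOfEntries]

lemma rightAct_coordInv (g T : PosUpper m) : rightAct g T.coordInv = (g * T).coordInv := by
  rw [rightAct_apply, coordInv, upperOfEntries_coord, coordInv, coord, mul_inv_rev, val_mul]

lemma rightAct_inv_rightAct (g : PosUpper m) (x : UpperIdx m → ℝ) :
    rightAct g⁻¹ (rightAct g x) = x := by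
  rw [rightAct_apply, rightAct_apply, upperOfEntries_entries
    ((upperOfEntries_isUpperTriangular x).mul g⁻¹.isPosUpper.1), inv_inv, Matrix.mul_assoc,
    inv_val_mul_val, Matrix.mul_one, entries_upperOfEntries]

lemma symmAct_coordGram (g T : PosUpper m) : symmAct g T.coordGram = (g * T).coordGram := by
  rw [symmAct_apply, symmOfEntries_coordGram, coordGram, gram_mul]

lemma symmAct_inv_symmAct (g : PosUpper m) (x : UpperIdx m → ℝ) :
    symmAct g⁻¹ (symmAct g x) = x := by
  have hs : (g.val * symmOfEntries x * g.valᵀ)ᵀ = g.val * symmOfEntries x * g.valᵀ := by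
    rw [Matrix.transpose_mul, Matrix.transpose_mul, Matrix.transpose_transpose,
      symmOfEntries_transpose, Matrix.mul_assoc]
  have h : g⁻¹.val * (g.val * symmOfEntries x * g.valᵀ) * g⁻¹.valᵀ = symmOfEntries x := by
    rw [Matrix.mul_assoc, Matrix.mul_assoc (g.val * _), ← Matrix.transpose_mul, inv_val_mul_val,
      Matrix.transpose_one, Matrix.mul_one, ← Matrix.mul_assoc, inv_val_mul_val, Matrix.one_mul]
  rw [symmAct_apply, symmAct_apply, symmOfEntries_entries hs, h, entries_symmOfEntries]

/-- The Jacobian of left translation by `g`. -/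
def leftJac (g : PosUpper m) : ℝ := ∏ p : UpperIdx m, g.val p.1.1 p.1.1

/-- The inverse Jacobian of right translation by `g⁻¹`. -/
def rightJac (g : PosUpper m) : ℝ := ∏ p : UpperIdx m, g.val p.1.2 p.1.2

lemma map_leftAct (g : PosUpper m) :
    (volume : Measure (UpperIdx m → ℝ)).map (leftAct g) =
      ENNReal.ofReal (leftJac g)⁻¹ • volume := by
  have key : ∀ p q : UpperIdx m, leftAct g (Pi.single q 1) p =
      if p.1.2 = q.1.2 then g.val p.1.1 q.1.1 else 0 := fun p q => by
    rw [leftAct_apply, upperOfEntries_single, entries]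
    split_ifs with h
    · rw [h, Matrix.mul_single_apply_same, mul_one]
    · rw [Matrix.mul_single_apply_of_ne _ _ _ _ _ h]
  refine map_volume_of_triangular lexIdx_injective _ (fun p => g.diag_pos p.1.1)
    (fun p q hpq => ?_) fun p => by rw [key, if_pos rfl]
  rw [key]
  split_ifs with h
  · by_contra h0
    refine not_le_of_lexIdx_lt hpq ⟨not_lt.1 fun h1 => h0 (g.isPosUpper.1 h1), h.le⟩
  · rfl

lemma map_rightAct (g : PosUpper m) :
    (volume : Measure (UpperIdx m → ℝ)).map (rightAct g) =
      ENNReal.ofReal (rightJac g)⁻¹⁻¹ • volume := by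
  have key : ∀ p q : UpperIdx m, rightAct g (Pi.single q 1) p =
      if p.1.1 = q.1.1 then g⁻¹.val q.1.2 p.1.2 else 0 := fun p q => by
    rw [rightAct_apply, upperOfEntries_single, entries]
    split_ifs with h
    · rw [h, Matrix.single_mul_apply_same, one_mul]
    · rw [Matrix.single_mul_apply_of_ne _ _ _ _ _ h]
  have hjac : (rightJac g)⁻¹ = ∏ p : UpperIdx m, g⁻¹.val p.1.2 p.1.2 := by
    rw [rightJac, ← Finset.prod_inv_distrib]
    exact Finset.prod_congr rfl fun p _ => (diag_inv g _).symm
  rw [hjac]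
  refine map_volume_of_triangular (OrderDual.toDual.injective.comp lexIdx_injective) _
    (fun p => g⁻¹.diag_pos p.1.2) (fun p q hpq => ?_) fun p => by rw [key, if_pos rfl]
  rw [key]
  split_ifs with h
  · by_contra h0
    refine not_le_of_lexIdx_lt (OrderDual.toDual_lt_toDual.1 hpq)
      ⟨h.ge, not_lt.1 fun h1 => h0 (g⁻¹.isPosUpper.1 h1)⟩
  · rfl

lemma map_symmAct (g : PosUpper m) :
    (volume : Measure (UpperIdx m → ℝ)).map (symmAct g) =
      ENNReal.ofReal (leftJac g * rightJac g)⁻¹ • volume := by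
  have hs : ∀ a b i j : Fin m, (g.val * Matrix.single a b (1 : ℝ) * g.valᵀ) i j =
      g.val i a * g.val j b := fun a b i j => by
    rw [Matrix.mul_apply, Finset.sum_eq_single b]
    · rw [Matrix.mul_single_apply_same, mul_one, Matrix.transpose_apply]
    · intro k _ hk
      rw [Matrix.mul_single_apply_of_ne _ _ _ _ _ hk, zero_mul]
    · simp
  have key : ∀ p q : UpperIdx m, symmAct g (Pi.single q 1) p =
      g.val p.1.1 q.1.1 * g.val p.1.2 q.1.2 +
        if q.1.1 = q.1.2 then 0 else g.val p.1.1 q.1.2 * g.val p.1.2 q.1.1 := fun p q => by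
    rw [symmAct_apply, symmOfEntries_single, entries, Matrix.mul_add, Matrix.add_mul,
      Matrix.add_apply, hs]
    split_ifs with h
    · simp
    · rw [hs]
  rw [leftJac, rightJac, ← Finset.prod_mul_distrib]
  refine map_volume_of_triangular lexIdx_injective _
    (fun p => mul_pos (g.diag_pos p.1.1) (g.diag_pos p.1.2)) (fun p q hpq => ?_) fun p => ?_
  · have hn := not_le_of_lexIdx_lt hpq
    have hz : ∀ i j : Fin m, ¬ i ≤ j → g.val i j = 0 := fun i j h => g.isPosUpper.1 (not_le.1 h)
    have hp := p.2
    have hq := q.2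
    rw [key]
    have h1 : g.val p.1.1 q.1.1 * g.val p.1.2 q.1.2 = 0 := by
      by_cases h : p.1.1 ≤ q.1.1
      · rw [hz p.1.2 q.1.2 fun h' => hn ⟨h, h'⟩, mul_zero]
      · rw [hz _ _ h, zero_mul]
    have h2 : g.val p.1.1 q.1.2 * g.val p.1.2 q.1.1 = 0 := by
      by_cases h : p.1.2 ≤ q.1.1
      · exact absurd ⟨hp.trans h, h.trans hq⟩ hn
      · rw [hz _ _ h, mul_zero]
    simp [h1, h2]
  · rw [key]
    split_ifs with h
    · rw [add_zero]
    · rw [g.isPosUpper.1 (show p.1.1 < p.1.2 from lt_of_le_of_ne p.2 h), mul_zero, add_zero]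

lemma leftJac_pos (g : PosUpper m) : 0 < leftJac g := Finset.prod_pos fun _ _ => g.diag_pos _

lemma rightJac_pos (g : PosUpper m) : 0 < rightJac g := Finset.prod_pos fun _ _ => g.diag_pos _

lemma leftJac_mul (g h : PosUpper m) : leftJac (g * h) = leftJac g * leftJac h := by
  simp only [leftJac, diag_mul, Finset.prod_mul_distrib]

lemma rightJac_mul (g h : PosUpper m) : rightJac (g * h) = rightJac g * rightJac h := by
  simp only [rightJac, diag_mul, Finset.prod_mul_distrib]

lemma measurable_leftJac : Measurable (leftJac : PosUpper m → ℝ) :=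
  Finset.measurable_fun_prod _ fun _ _ => measurable_val_apply _ _

lemma measurable_rightJac : Measurable (rightJac : PosUpper m → ℝ) :=
  Finset.measurable_fun_prod _ fun _ _ => measurable_val_apply _ _

@[to_additive]
lemma prod_upperIdx {M : Type*} [CommMonoid M] (f : Fin m × Fin m → M) :
    ∏ p : UpperIdx m, f p = ∏ i, ∏ j, if i ≤ j then f (i, j) else 1 := by
  rw [← Finset.prod_subtype (Finset.univ.filter fun p : Fin m × Fin m => p.1 ≤ p.2)
    (fun p => by simp) f, Finset.prod_filter, Fintype.prod_prod_type]

lemma leftJac_eq (g : PosUpper m) : leftJac g = ∏ j : Fin m, g.val j j ^ (m - (j : ℕ)) := by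
  rw [leftJac, prod_upperIdx (fun p => g.val p.1 p.1)]
  refine Finset.prod_congr rfl fun i _ => ?_
  rw [← Finset.prod_filter, Finset.filter_le_eq_Ici]
  simp

lemma rightJac_eq (g : PosUpper m) : rightJac g = ∏ j : Fin m, g.val j j ^ ((j : ℕ) + 1) := by
  rw [rightJac, prod_upperIdx (fun p => g.val p.2 p.2), Finset.prod_comm]
  refine Finset.prod_congr rfl fun i _ => ?_
  rw [← Finset.prod_filter, Finset.filter_ge_eq_Iic]
  simp

lemma leftJac_mul_rightJac (g : PosUpper m) : leftJac g * rightJac g = g.val.det ^ (m + 1) := by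
  rw [leftJac_eq, rightJac_eq, ← Finset.prod_mul_distrib, g.isPosUpper.det_eq, ← Finset.prod_pow]
  refine Finset.prod_congr rfl fun j _ => ?_
  rw [← pow_add]
  congr 1
  omega

/-! ### Left invariant measures on the triangular group -/

/-- The left invariant measure `∏_i t_{ii}^{-(m-i+1)} dT`, with `i` counted from `1`. -/
def haarLeft (m : ℕ) : Measure (PosUpper m) :=
  ((volume : Measure (UpperIdx m → ℝ)).comap coord).withDensity
    fun T => ENNReal.ofReal (leftJac T)⁻¹

/-- The left invariant measure that the inversion `T = U⁻¹` makes of the right invariant measure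
`∏_j u_{jj}^{-j} dU`, with `j` counted from `1`. -/
def haarInv (m : ℕ) : Measure (PosUpper m) :=
  ((volume : Measure (UpperIdx m → ℝ)).comap coordInv).withDensity
    fun T => ENNReal.ofReal (rightJac T)⁻¹⁻¹

/-- The left invariant measure that `A = T Tᵀ` makes of `det A ^ (-(m+1)/2) dA`. -/
def haarSymm (m : ℕ) : Measure (PosUpper m) :=
  ((volume : Measure (UpperIdx m → ℝ)).comap coordGram).withDensity
    fun T => ENNReal.ofReal (leftJac T * rightJac T)⁻¹

instance : (haarLeft m).IsMulLeftInvariant :=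
  isMulLeftInvariant_comap_withDensity measurableEmbedding_coord
    (fun g => measurable_linearMap (leftAct g)) leftAct_coord leftAct_inv_leftAct
    measurable_leftJac leftJac_pos leftJac_mul map_leftAct

instance : (haarInv m).IsMulLeftInvariant :=
  isMulLeftInvariant_comap_withDensity measurableEmbedding_coordInv
    (fun g => measurable_linearMap (rightAct g)) rightAct_coordInv rightAct_inv_rightAct
    measurable_rightJac.inv (fun g => inv_pos.2 (rightJac_pos g))
    (fun g h => by rw [Pi.inv_apply, Pi.inv_apply, Pi.inv_apply, rightJac_mul, mul_inv])
    map_rightAct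

instance : (haarSymm m).IsMulLeftInvariant :=
  isMulLeftInvariant_comap_withDensity measurableEmbedding_coordGram
    (fun g => measurable_linearMap (symmAct g)) symmAct_coordGram symmAct_inv_symmAct
    (measurable_leftJac.mul measurable_rightJac)
    (fun g => mul_pos (leftJac_pos g) (rightJac_pos g))
    (fun g h => by
      simp only [Pi.mul_apply, leftJac_mul, rightJac_mul]
      ring)
    map_symmAct

instance : SigmaFinite (haarLeft m) := by
  have := measurableEmbedding_coord.sigmaFinite_comap (volume : Measure (UpperIdx m → ℝ))
  exact SigmaFinite.withDensity_ofReal _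

instance : SigmaFinite (haarInv m) := by
  have := measurableEmbedding_coordInv.sigmaFinite_comap (volume : Measure (UpperIdx m → ℝ))
  exact SigmaFinite.withDensity_ofReal _

instance : SigmaFinite (haarSymm m) := by
  have := measurableEmbedding_coordGram.sigmaFinite_comap (volume : Measure (UpperIdx m → ℝ))
  exact SigmaFinite.withDensity_ofReal _

lemma comap_withDensity_ne_zero {q : PosUpper m → UpperIdx m → ℝ} (hq : MeasurableEmbedding q)
    (hr : volume (Set.range q) ≠ 0) {χ : PosUpper m → ℝ} (hχ : Measurable χ)
    (h0 : ∀ T, 0 < χ T) :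
    ((volume : Measure (UpperIdx m → ℝ)).comap q).withDensity
      (fun T => ENNReal.ofReal (χ T)) ≠ 0 := by
  intro h
  rw [withDensity_eq_zero_iff hχ.ennreal_ofReal.aemeasurable] at h
  refine hr ?_
  have h1 : (volume : Measure (UpperIdx m → ℝ)).comap q = 0 := by
    rw [← ae_eq_bot, ← Filter.empty_mem_iff_bot]
    filter_upwards [h] with T hT
    exact absurd hT (by simpa using h0 T)
  rw [← Set.image_univ, ← hq.comap_apply, h1, Measure.coe_zero, Pi.zero_apply]

lemma volume_range_coord_ne_zero :
    volume (Set.range (coord : PosUpper m → UpperIdx m → ℝ)) ≠ 0 := by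
  rw [range_coord]
  have ho : IsOpen {x : UpperIdx m → ℝ | ∀ j, 0 < x ⟨(j, j), le_rfl⟩} := by
    rw [Set.ofPred_forall]
    exact isOpen_iInter_of_finite fun j => isOpen_lt continuous_const (continuous_apply _)
  exact (ho.measure_pos volume ⟨fun _ => 1, fun _ => one_pos⟩).ne'

/-- Adding a large multiple of the identity makes a symmetric matrix positive definite, so the
space of symmetric matrices is a countable union of translates of the positive definite cone, which
therefore is not a null set. -/
lemma volume_range_coordGram_ne_zero :
    volume (Set.range (coordGram : PosUpper m → UpperIdx m → ℝ)) ≠ 0 := by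
  rw [range_coordGram]
  intro h
  have hcover : ∀ x : UpperIdx m → ℝ, ∃ N : ℕ,
      (symmOfEntries ((N : ℝ) • entries (1 : SqMat m) + x)).PosDef := by
    intro x
    obtain ⟨N, hN⟩ := exists_nat_gt (∑ i, ∑ j, |symmOfEntries x i j|)
    refine ⟨N, ?_⟩
    have hsum : symmOfEntries ((N : ℝ) • entries (1 : SqMat m) + x) =
        (N : ℝ) • (1 : SqMat m) + symmOfEntries x := by
      have h1 := map_add (symmₗ m) ((N : ℝ) • entries (1 : SqMat m)) x
      rw [map_smul] at h1
      exact h1.trans (by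
        rw [show symmₗ m (entries 1) = 1 from symmOfEntries_entries Matrix.transpose_one]; rfl)
    rw [hsum]
    refine Matrix.PosDef.of_dotProduct_mulVec_pos ?_ fun v hv => ?_
    · rw [Matrix.IsHermitian, Matrix.conjTranspose_eq_transpose_of_trivial]
      rw [Matrix.transpose_add, symmOfEntries_transpose, Matrix.transpose_smul,
        Matrix.transpose_one]
    · have hv0 : 0 < v ⬝ᵥ v := by
        have := Matrix.dotProduct_star_self_pos_iff.2 hv
        simpa using this
      have hle : ∀ i, v i ^ 2 ≤ v ⬝ᵥ v := fun i => by
        rw [dotProduct, sq]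
        exact Finset.single_le_sum (f := fun k => v k * v k) (fun k _ => mul_self_nonneg _)
          (Finset.mem_univ i)
      have hlow : -((∑ i, ∑ j, |symmOfEntries x i j|) * (v ⬝ᵥ v)) ≤
          v ⬝ᵥ symmOfEntries x *ᵥ v := by
        have h0 : v ⬝ᵥ symmOfEntries x *ᵥ v =
            ∑ i, ∑ j, v i * (symmOfEntries x i j * v j) := by
          simp only [Matrix.mulVec, dotProduct, Finset.mul_sum]
        rw [h0, Finset.sum_mul, ← Finset.sum_neg_distrib]
        simp only [Finset.sum_mul, ← Finset.sum_neg_distrib]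
        refine Finset.sum_le_sum fun i _ => Finset.sum_le_sum fun j _ => ?_
        have h1 : |v i * v j| ≤ v ⬝ᵥ v := abs_le.2
          ⟨by nlinarith [hle i, hle j, sq_nonneg (v i + v j)],
            by nlinarith [hle i, hle j, sq_nonneg (v i - v j)]⟩
        have h2 := mul_le_mul_of_nonneg_left h1 (abs_nonneg (symmOfEntries x i j))
        rw [← abs_mul] at h2
        have h3 := neg_abs_le (symmOfEntries x i j * (v i * v j))
        linarith
      rw [star_trivial, Matrix.add_mulVec, dotProduct_add, Matrix.smul_mulVec, Matrix.one_mulVec,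
        dotProduct_smul, smul_eq_mul]
      nlinarith
  have hnull : volume (Set.univ : Set (UpperIdx m → ℝ)) = 0 := by
    have : (Set.univ : Set (UpperIdx m → ℝ)) =
        ⋃ N : ℕ, (fun x => (N : ℝ) • entries (1 : SqMat m) + x) ⁻¹'
          {x | (symmOfEntries x).PosDef} := by
      ext x
      simpa using hcover x
    rw [this]
    refine measure_iUnion_null fun N => ?_
    rw [measure_preimage_add]
    exact h
  exact isOpen_univ.measure_ne_zero volume Set.univ_nonempty hnull

lemma haarLeft_ne_zero : haarLeft m ≠ 0 :=
  comap_withDensity_ne_zero measurableEmbedding_coord volume_range_coord_ne_zero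
    measurable_leftJac.inv fun T => inv_pos.2 (leftJac_pos T)

lemma haarInv_ne_zero : haarInv m ≠ 0 :=
  comap_withDensity_ne_zero measurableEmbedding_coordInv
    (by rw [range_coordInv]; exact volume_range_coord_ne_zero)
    measurable_rightJac.inv.inv fun T => inv_pos.2 (inv_pos.2 (rightJac_pos T))

lemma haarSymm_ne_zero : haarSymm m ≠ 0 :=
  comap_withDensity_ne_zero measurableEmbedding_coordGram volume_range_coordGram_ne_zero
    (measurable_leftJac.mul measurable_rightJac).inv
    fun T => inv_pos.2 (mul_pos (leftJac_pos T) (rightJac_pos T))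

end PosUpper

/-! ### The densities on the triangular group -/

namespace PosUpper

open SqMat

variable {m : ℕ}

/-- `exp (-tr (Ω T Tᵀ) / 2) (det T) ^ n`: in the coordinate `T`, with `A = T Tᵀ`, the unnormalized
Wishart density relative to any left invariant measure. -/
def weight (n : ℝ) (Ω : SqMat m) (T : PosUpper m) : ℝ :=
  Real.exp (-(1 / 2) * (Ω * T.gram).trace) * T.val.det ^ n

lemma weight_pos (n : ℝ) (Ω : SqMat m) (T : PosUpper m) : 0 < weight n Ω T :=
  mul_pos (Real.exp_pos _) (Real.rpow_pos_of_pos T.det_pos n)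

end PosUpper

lemma SqMat.measurable_trace_mul {m : ℕ} (Ω : SqMat m) :
    Measurable fun A : SqMat m => (Ω * A).trace :=
  ((continuous_const.matrix_mul continuous_id).matrix_trace).measurable

namespace PosUpper

open SqMat

variable {m : ℕ}

lemma measurable_weight (n : ℝ) (Ω : SqMat m) : Measurable (weight n Ω) :=
  ((((measurable_trace_mul Ω).comp measurable_gram).const_mul _).exp).mul
    ((measurable_det.comp measurable_val).pow_const n)

end PosUpper

lemma measurable_wishartKernel {m : ℕ} (n : ℝ) (S : SqMat m) : Measurable (wishartKernel n S) := by
  classical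
  refine Measurable.ite measurableSet_posDef ?_ measurable_const
  exact (((SqMat.measurable_trace_mul S⁻¹).const_mul _).exp).mul
    (SqMat.measurable_det.pow_const _)

lemma measurable_cholInvWishartKernel {m : ℕ} (n : ℝ) (V : SqMat m) :
    Measurable (cholInvWishartKernel n V) := by
  classical
  refine Measurable.ite SqMat.measurableSet_isPosUpper ?_ measurable_const
  have h1 : Measurable fun U : SqMat m => V * U⁻¹ :=
    ((continuous_const.matrix_mul continuous_id).measurable (f := fun A : SqMat m => V * A)).comp
      SqMat.measurable_inv
  exact ((((SqMat.measurable_frobNorm.comp h1).pow_const 2).const_mul _).exp).mul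
    (Finset.measurable_fun_prod _ fun j _ => (SqMat.measurable_entry j j).pow_const _)

namespace PosUpper

open SqMat

variable {m : ℕ}

lemma wishartKernel_gram (n : ℝ) (S : SqMat m) (T : PosUpper m) :
    wishartKernel n S T.gram = (leftJac T * rightJac T)⁻¹ * weight n S⁻¹ T := by
  have hd := T.det_pos
  rw [wishartKernel, if_pos T.gram_posDef, leftJac_mul_rightJac, weight, det_gram,
    ← Real.rpow_natCast (_ : ℝ) 2, ← Real.rpow_mul hd.le,
    show ((2 : ℕ) : ℝ) * ((n - m - 1) / 2) = n - ((m + 1 : ℕ) : ℝ) by push_cast; ring,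
    Real.rpow_sub hd, Real.rpow_natCast]
  field_simp

/-- The unnormalized Wishart law in the coordinate `T`. -/
theorem wishartUnnormalized_eq_map (n : ℝ) (S : SqMat m) :
    wishartUnnormalized n S =
      ((haarSymm m).withDensity fun T => ENNReal.ofReal (weight n S⁻¹ T)).map gram := by
  have hk : Measurable fun A : SqMat m => ENNReal.ofReal (wishartKernel n S A) :=
    (measurable_wishartKernel n S).ennreal_ofReal
  have hcomp : (gram : PosUpper m → SqMat m) = symmOfEntries ∘ coordGram :=
    funext fun T => (symmOfEntries_coordGram T).symm
  rw [wishartUnnormalized, symmLebesgue, ← withDensity_comp_map measurable_symmOfEntries _ hk,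
    ← measurableEmbedding_coordGram.map_comap_withDensity _ (hk.comp measurable_symmOfEntries),
    Measure.map_map measurable_symmOfEntries measurableEmbedding_coordGram.measurable, ← hcomp,
    haarSymm, ← withDensity_mul]
  · congr 2
    ext T
    simp only [Function.comp_apply, Pi.mul_apply]
    rw [symmOfEntries_coordGram, wishartKernel_gram,
      ENNReal.ofReal_mul (inv_pos.2 (mul_pos (leftJac_pos T) (rightJac_pos T))).le]
  · exact (measurable_leftJac.mul measurable_rightJac).inv.ennreal_ofReal
  · exact (measurable_weight n _).ennreal_ofReal
  · refine .of_forall fun x hx => ?_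
    rw [range_coordGram] at hx
    have hx' : ¬ (symmOfEntries x).PosDef := hx
    rw [Function.comp_apply, wishartKernel, if_neg hx', ENNReal.ofReal_zero]

lemma prod_diag_rpow (T : PosUpper m) (n : ℝ) : T.val.det ^ n = ∏ j, T.val j j ^ n := by
  rw [T.isPosUpper.det_eq, Real.finsetProd_rpow _ _ fun j _ => (T.diag_pos j).le]

lemma cholInvWishartKernel_inv (n : ℝ) (V T : PosUpper m) :
    cholInvWishartKernel n V.val T⁻¹.val =
      (rightJac T)⁻¹⁻¹ * weight n (V.valᵀ * V.val) T := by
  have hfrob : frobNorm (V.val * T⁻¹.val⁻¹) ^ 2 = (V.valᵀ * V.val * T.gram).trace := by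
    rw [← val_inv, inv_inv, frobNorm, Real.sq_sqrt, Matrix.transpose_mul, Matrix.mul_assoc,
      Matrix.trace_mul_comm, gram]
    · simp only [Matrix.mul_assoc]
    · have h := (Matrix.posSemidef_conjTranspose_mul_self (V.val * T.val)).trace_nonneg
      rwa [Matrix.conjTranspose_eq_transpose_of_trivial] at h
  rw [cholInvWishartKernel, if_pos T⁻¹.isPosUpper, hfrob, weight, inv_inv, prod_diag_rpow,
    rightJac_eq, mul_left_comm, ← Finset.prod_mul_distrib]
  congr 1
  refine Finset.prod_congr rfl fun j _ => ?_
  have hj := T.diag_pos j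
  rw [diag_inv, Real.inv_rpow hj.le, Real.rpow_neg hj.le, inv_inv, ← Real.rpow_natCast,
    ← Real.rpow_add hj]
  congr 1
  push_cast
  ring

/-- The measure with the Cholesky-inverse-Wishart density in the coordinate `T = U⁻¹`. -/
theorem upperLebesgue_withDensity_eq_map (n : ℝ) (V : PosUpper m) :
    (upperLebesgue m).withDensity (fun U => ENNReal.ofReal (cholInvWishartKernel n V.val U)) =
      ((haarInv m).withDensity fun T =>
        ENNReal.ofReal (weight n (V.valᵀ * V.val) T)).map fun T => T⁻¹.val := by
  have hk : Measurable fun U : SqMat m => ENNReal.ofReal (cholInvWishartKernel n V.val U) :=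
    (measurable_cholInvWishartKernel n V.val).ennreal_ofReal
  have hcomp : (fun T : PosUpper m => T⁻¹.val) = upperOfEntries ∘ coordInv :=
    funext fun T => (upperOfEntries_coord T⁻¹).symm
  rw [upperLebesgue, ← withDensity_comp_map measurable_upperOfEntries _ hk,
    ← measurableEmbedding_coordInv.map_comap_withDensity _ (hk.comp measurable_upperOfEntries),
    Measure.map_map measurable_upperOfEntries measurableEmbedding_coordInv.measurable, ← hcomp,
    haarInv, ← withDensity_mul]
  · congr 2
    ext T
    simp only [Function.comp_apply, Pi.mul_apply]
    rw [coordInv, upperOfEntries_coord, cholInvWishartKernel_inv,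
      ENNReal.ofReal_mul (inv_pos.2 (inv_pos.2 (rightJac_pos T))).le]
  · exact measurable_rightJac.inv.inv.ennreal_ofReal
  · exact (measurable_weight n _).ennreal_ofReal
  · refine .of_forall fun x hx => ?_
    rw [Function.comp_apply, cholInvWishartKernel, if_neg, ENNReal.ofReal_zero]
    intro hU
    refine hx ⟨(mk _ hU)⁻¹, ?_⟩
    rw [coordInv, inv_inv, coord, val_mk, entries_upperOfEntries]

/-! ### Finiteness of the normalizing constant -/

/-- The one-dimensional factors of `weight n 1` relative to Lebesgue measure: Gaussian off the
diagonal, of chi type on the diagonal. -/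
def weightFactor (n : ℝ) (p : UpperIdx m) (x : ℝ) : ℝ :=
  if p.1.1 = p.1.2 then
    (Set.Ioi 0).indicator (fun x => x ^ (n - ((m - (p.1.1 : ℕ) : ℕ) : ℝ)) *
      Real.exp (-(1 / 2) * x ^ 2)) x
  else Real.exp (-(1 / 2) * x ^ 2)

lemma integrable_weightFactor {n : ℝ} (hn : (m : ℝ) - 1 < n) (p : UpperIdx m) :
    Integrable (weightFactor n p) := by
  unfold weightFactor
  split_ifs with h
  · rw [integrable_indicator_iff measurableSet_Ioi]
    refine integrableOn_rpow_mul_exp_neg_mul_sq (by norm_num) ?_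
    have : ((m - (p.1.1 : ℕ) : ℕ) : ℝ) ≤ m := by exact_mod_cast Nat.sub_le _ _
    linarith
  · exact integrable_exp_neg_mul_sq (by norm_num)

lemma weight_one_eq_prod (n : ℝ) (T : PosUpper m) :
    (leftJac T)⁻¹ * weight n 1 T = ∏ p, weightFactor n p (T.coord p) := by
  have htr : (1 * T.gram).trace = ∑ p : UpperIdx m, T.coord p ^ 2 := by
    have h := sum_upperIdx (fun p : Fin m × Fin m => T.val p.1 p.2 ^ 2)
    refine Eq.trans ?_ h.symm
    rw [Matrix.one_mul, gram, Matrix.trace]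
    refine Finset.sum_congr rfl fun i _ => ?_
    rw [Matrix.diag_apply, Matrix.mul_apply]
    refine Finset.sum_congr rfl fun j _ => ?_
    split_ifs with hij
    · rw [Matrix.transpose_apply, sq]
    · rw [T.isPosUpper.1 (not_le.1 hij), zero_mul]
  let D : Fin m × Fin m → ℝ := fun q =>
    if q.1 = q.2 then T.val q.1 q.1 ^ (n - ((m - (q.1 : ℕ) : ℕ) : ℝ)) else 1
  have hfac : ∀ p : UpperIdx m, weightFactor n p (T.coord p) =
      Real.exp (-(1 / 2) * T.coord p ^ 2) *
        D p.1 := fun p => by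
    obtain ⟨⟨i, j⟩, hij⟩ := p
    by_cases h : i = j
    · subst h
      have : coord T ⟨(i, i), hij⟩ = T.val i i := rfl
      simp [weightFactor, D, this, T.diag_pos i, mul_comm]
    · simp [weightFactor, D, h]
  have hdiag : ∏ p : UpperIdx m, D p.1 =
      ∏ j : Fin m, T.val j j ^ (n - ((m - (j : ℕ) : ℕ) : ℝ)) := by
    refine (prod_upperIdx D).trans ?_
    refine Finset.prod_congr rfl fun i _ => ?_
    rw [Finset.prod_eq_single i]
    · simp [D]
    · intro j _ hj
      simp [D, hj.symm]
    · simp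
  rw [Finset.prod_congr rfl fun p _ => hfac p, Finset.prod_mul_distrib, hdiag, ← Real.exp_sum,
    ← Finset.mul_sum, weight, htr, prod_diag_rpow, leftJac_eq, mul_left_comm,
    ← Finset.prod_inv_distrib, ← Finset.prod_mul_distrib]
  congr 1
  refine Finset.prod_congr rfl fun j _ => ?_
  rw [Real.rpow_sub (T.diag_pos j), Real.rpow_natCast]
  field_simp

lemma lintegral_weight_one_lt_top {n : ℝ} (hn : (m : ℝ) - 1 < n) :
    ∫⁻ T, ENNReal.ofReal (weight n (1 : SqMat m) T) ∂haarLeft m < ∞ := by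
  have hint : Integrable fun x : UpperIdx m → ℝ => ∏ p, weightFactor n p (x p) :=
    Integrable.fintype_prod fun p => integrable_weightFactor hn p
  have hm : Measurable fun T : PosUpper m => ENNReal.ofReal (leftJac T)⁻¹ :=
    measurable_leftJac.inv.ennreal_ofReal
  rw [haarLeft, lintegral_withDensity_eq_lintegral_mul _ hm (measurable_weight n _).ennreal_ofReal]
  calc _ = ∫⁻ T : PosUpper m, ENNReal.ofReal (∏ p, weightFactor n p (T.coord p))
        ∂(volume : Measure (UpperIdx m → ℝ)).comap coord := by
        refine lintegral_congr fun T => ?_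
        rw [Pi.mul_apply, ← ENNReal.ofReal_mul (inv_pos.2 (leftJac_pos T)).le, weight_one_eq_prod]
    _ = ∫⁻ x in Set.range coord, ENNReal.ofReal (∏ p, weightFactor n p (x p)) := by
        rw [← measurableEmbedding_coord.map_comap, measurableEmbedding_coord.lintegral_map]
    _ ≤ ∫⁻ x : UpperIdx m → ℝ, ENNReal.ofReal (∏ p, weightFactor n p (x p)) :=
        setLIntegral_le_lintegral _ _
    _ < ∞ := hint.lintegral_lt_top

/-- Left invariance reduces the case of `Ω = Vᵀ V` to that of the identity. -/
lemma lintegral_weight_lt_top {n : ℝ} (hn : (m : ℝ) - 1 < n) (V : PosUpper m) :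
    ∫⁻ T, ENNReal.ofReal (weight n (V.valᵀ * V.val) T) ∂haarLeft m < ∞ := by
  rw [← lintegral_mul_left_eq_self _ V⁻¹]
  have h : ∀ T, weight n (V.valᵀ * V.val) (V⁻¹ * T) = V⁻¹.val.det ^ n * weight n 1 T := fun T => by
    have h1 : (V.valᵀ * V.val * (V⁻¹ * T).gram).trace = (1 * T.gram).trace := by
      rw [Matrix.mul_assoc, Matrix.trace_mul_comm, gram_mul]
      have h2 := inv_val_mul_val V⁻¹
      rw [inv_inv] at h2
      rw [← Matrix.mul_assoc, ← Matrix.mul_assoc, h2, Matrix.one_mul, Matrix.mul_assoc,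
        ← Matrix.transpose_mul, h2, Matrix.transpose_one, Matrix.mul_one]
    rw [weight, weight, h1, det_mul, Real.mul_rpow V⁻¹.det_pos.le T.det_pos.le]
    ring
  simp only [h]
  simp only [ENNReal.ofReal_mul (Real.rpow_nonneg V⁻¹.det_pos.le n)]
  rw [lintegral_const_mul _ (measurable_weight n _).ennreal_ofReal]
  exact ENNReal.mul_lt_top ENNReal.ofReal_lt_top (lintegral_weight_one_lt_top hn)

end PosUpper

/-! ### Products of measures with densities -/

lemma pi_withDensity_ofReal {ι : Type*} [Fintype ι] {X : ι → Type*} [∀ i, MeasurableSpace (X i)]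
    (μ : ∀ i, Measure (X i)) [∀ i, SigmaFinite (μ i)] {f : ∀ i, X i → ℝ}
    (hf : ∀ i, Integrable (f i) (μ i)) (h0 : ∀ i x, 0 ≤ f i x) :
    Measure.pi (fun i => (μ i).withDensity fun x => ENNReal.ofReal (f i x)) =
      (Measure.pi μ).withDensity fun x => ENNReal.ofReal (∏ i, f i (x i)) := by
  classical
  have (i : ι) : IsFiniteMeasure ((μ i).withDensity fun x => ENNReal.ofReal (f i x)) :=
    isFiniteMeasure_withDensity_ofReal (hf i).2
  refine Measure.pi_eq fun s hs => ?_
  have hi : ∀ i, Integrable ((s i).indicator (f i)) (μ i) := fun i => (hf i).indicator (hs i)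
  have hi0 : ∀ i x, 0 ≤ (s i).indicator (f i) x := fun i x =>
    Set.indicator_nonneg (fun x _ => h0 i x) x
  have hprod : ∀ x : ∀ i, X i, (Set.univ.pi s).indicator
      (fun x => ENNReal.ofReal (∏ i, f i (x i))) x =
        ENNReal.ofReal (∏ i, (s i).indicator (f i) (x i)) := fun x => by
    by_cases hx : x ∈ Set.univ.pi s
    · rw [Set.indicator_of_mem hx]
      congr 1
      exact Finset.prod_congr rfl fun i _ => (Set.indicator_of_mem (hx i trivial) _).symm
    · rw [Set.indicator_of_notMem hx]
      obtain ⟨i, hxi⟩ : ∃ i, x i ∉ s i := by simpa using hx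
      rw [Finset.prod_eq_zero (Finset.mem_univ i) (Set.indicator_of_notMem hxi _),
        ENNReal.ofReal_zero]
  rw [withDensity_apply _ (MeasurableSet.univ_pi hs), ← lintegral_indicator (.univ_pi hs)]
  simp only [hprod]
  rw [← ofReal_integral_eq_lintegral_ofReal (Integrable.fintype_prod_dep hi)
    (.of_forall fun x => Finset.prod_nonneg fun i _ => hi0 i (x i)),
    integral_fintype_prod_eq_prod,
    ENNReal.ofReal_prod_of_nonneg fun i _ => integral_nonneg (hi0 i)]
  refine Finset.prod_congr rfl fun i _ => ?_
  rw [integral_indicator (hs i), withDensity_apply _ (hs i),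
    ofReal_integral_eq_lintegral_ofReal (hf i).integrableOn (.of_forall (h0 i))]

/-! ### The scatter matrix `Z Zᵀ` of a rectangular matrix -/

section Scatter

variable {m k : ℕ}

/-- The `m × m` matrix `Z Zᵀ`, where `z` is the family of the `k` columns of `Z`. -/
def scatter (z : Fin k → Fin m → ℝ) : SqMat m :=
  (Matrix.of z)ᵀ * Matrix.of z

lemma scatter_apply (z : Fin k → Fin m → ℝ) (i j : Fin m) :
    scatter z i j = ∑ l, z l i * z l j := rfl

lemma measurable_scatter : Measurable (scatter : (Fin k → Fin m → ℝ) → SqMat m) := by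
  refine SqMat.measurable_of_entries fun i j => ?_
  simp only [scatter_apply]
  fun_prop

/-- Multiplication of all columns by a matrix. -/
def colAct (k : ℕ) (M : SqMat m) : (Fin k → Fin m → ℝ) →ₗ[ℝ] Fin k → Fin m → ℝ :=
  LinearMap.pi fun l => (Matrix.toLin' M).comp (LinearMap.proj l)

lemma measurable_colAct (M : SqMat m) : Measurable (colAct k M) :=
  (LinearMap.continuous_of_finiteDimensional _).measurable

lemma scatter_colAct (M : SqMat m) (z : Fin k → Fin m → ℝ) :
    scatter (colAct k M z) = M * scatter z * Mᵀ := by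
  have h : (Matrix.of (colAct k M z))ᵀ = M * (Matrix.of z)ᵀ := by
    ext i l
    rfl
  rw [scatter, h, ← Matrix.transpose_transpose (Matrix.of (colAct k M z)), h,
    Matrix.transpose_mul, Matrix.transpose_transpose, scatter]
  simp only [Matrix.mul_assoc]

lemma map_colAct {M : SqMat m} (hM : M.det ≠ 0) :
    (volume : Measure (Fin k → Fin m → ℝ)).map (colAct k M) =
      ENNReal.ofReal |(M.det ^ k)⁻¹| • volume := by
  have hdet : LinearMap.det (colAct k M) = M.det ^ k := by
    rw [colAct, LinearMap.det_pi]
    simp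
  rw [Measure.map_linearMap_addHaar_eq_smul_addHaar _ (by rw [hdet]; exact pow_ne_zero k hM),
    hdet]

/-- The image of Lebesgue measure under `Z ↦ Z Zᵀ`. -/
def scatterLebesgue (k m : ℕ) : Measure (SqMat m) :=
  (volume : Measure (Fin k → Fin m → ℝ)).map scatter

/-- For `m ≤ k`, almost every `Z` has rank `m`. On each line `t ↦ Z + t E` in the direction of the
truncated identity `E`, the determinant of the leading square block is the value at `t` of the
characteristic polynomial of the negative of that block of `Z`, which has finitely many zeros. -/
lemma ae_posDef_scatter (hmk : m ≤ k) :
    ∀ᵐ z : Fin k → Fin m → ℝ, (scatter z).PosDef := by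
  let e : Fin k → Fin m → ℝ := fun l i => if Fin.castLE hmk i = l then 1 else 0
  let L : ℝ →ₗ[ℝ] Fin k → Fin m → ℝ := LinearMap.toSpanSingleton ℝ _ e
  refine ae_mem_of_ae_add_linearMap_mem L volume volume
    (s := {z : Fin k → Fin m → ℝ | (scatter z).PosDef})
    (measurable_scatter measurableSet_posDef) fun z => ?_
  let N : SqMat m := Matrix.of fun i j => z (Fin.castLE hmk j) i
  have hfin : ∀ᵐ t : ℝ, ¬ (-N).charpoly.IsRoot t := by
    have h0 : (-N).charpoly ≠ 0 := (Matrix.charpoly_monic _).ne_zero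
    have h1 : {t | (-N).charpoly.IsRoot t}.Finite := Polynomial.finite_setOfPred_isRoot h0
    exact measure_eq_zero_iff_ae_notMem.1 (h1.measure_zero volume)
  filter_upwards [hfin] with t ht
  have hdet : (Matrix.scalar (Fin m) t + N).det ≠ 0 := by
    rwa [Polynomial.IsRoot, Matrix.eval_charpoly, sub_neg_eq_add] at ht
  have hinj : Function.Injective (Matrix.of (z + L t)).mulVec := by
    rw [← Matrix.coe_mulVecLin, ← LinearMap.ker_eq_bot, LinearMap.ker_eq_bot']
    intro v hv
    have hv' : (Matrix.scalar (Fin m) t + N)ᵀ *ᵥ v = 0 := by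
      ext i
      have h2 := congrFun hv (Fin.castLE hmk i)
      refine Eq.trans ?_ h2
      simp only [Matrix.mulVecLin_apply, Matrix.mulVec, dotProduct]
      refine Finset.sum_congr rfl fun j _ => ?_
      congr 1
      simp [N, L, e, Matrix.diagonal_apply, add_comm]
    exact Matrix.eq_zero_of_mulVec_eq_zero (by rwa [Matrix.det_transpose]) hv'
  have := Matrix.PosDef.conjTranspose_mul_self _ hinj
  rwa [Matrix.conjTranspose_eq_transpose_of_trivial] at this

/-! ### Gaussian columns -/

lemma gaussianReal_eq_withDensity : gaussianReal 0 1 =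
    (volume : Measure ℝ).withDensity fun x => ENNReal.ofReal (gaussianPDFReal 0 1 x) := by
  rw [gaussianReal_of_var_ne_zero 0 one_ne_zero]
  rfl

lemma pi_pi_gaussianReal (k m : ℕ) : ∃ C : ℝ, 0 < C ∧
    Measure.pi (fun _ : Fin k => Measure.pi fun _ : Fin m => gaussianReal 0 1) =
      (volume : Measure (Fin k → Fin m → ℝ)).withDensity fun z =>
        ENNReal.ofReal (C * Real.exp (-(1 / 2) * (scatter z).trace)) := by
  have hint := integrable_gaussianPDFReal 0 1
  have h0 := gaussianPDFReal_nonneg 0 1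
  refine ⟨∏ _l : Fin k, ∏ _i : Fin m, (√(2 * Real.pi))⁻¹, by positivity, ?_⟩
  rw [gaussianReal_eq_withDensity, pi_withDensity_ofReal _ (fun _ => hint) fun _ => h0,
    pi_withDensity_ofReal _ (fun _ => Integrable.fintype_prod_dep fun _ => hint)
      fun _ x => Finset.prod_nonneg fun i _ => h0 (x i), volume_pi]
  congr 2
  ext z
  congr 1
  simp only [gaussianPDFReal, Finset.prod_mul_distrib, NNReal.coe_one, mul_one, sub_zero]
  congr 1
  simp only [← Real.exp_sum]
  congr 1
  rw [Matrix.trace, Finset.mul_sum, Finset.sum_comm]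
  refine Finset.sum_congr rfl fun i _ => ?_
  rw [Matrix.diag_apply, scatter_apply, Finset.mul_sum]
  refine Finset.sum_congr rfl fun l _ => ?_
  ring

instance : SigmaFinite (scatterLebesgue k m) := by
  obtain ⟨C, hC, h⟩ := pi_pi_gaussianReal k m
  let f : SqMat m → ℝ≥0∞ := fun A => ENNReal.ofReal (C * Real.exp (-(1 / 2) * A.trace))
  have hf : Measurable f := by
    have h1 := (SqMat.measurable_trace_mul (1 : SqMat m))
    simp only [Matrix.one_mul] at h1
    exact ((h1.const_mul _).exp.const_mul C).ennreal_ofReal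
  have hfin : IsFiniteMeasure ((scatterLebesgue k m).withDensity f) := by
    rw [scatterLebesgue, ← withDensity_comp_map measurable_scatter _ hf]
    have h2 : (volume : Measure (Fin k → Fin m → ℝ)).withDensity (f ∘ scatter) = _ := h.symm
    rw [h2]
    infer_instance
  have hpos : ∀ A, f A ≠ 0 := fun A => by
    have : 0 < C * Real.exp (-(1 / 2) * A.trace) := by positivity
    simpa [f] using this
  rw [← withDensity_inv_same (μ := scatterLebesgue k m) hf (.of_forall hpos)
    (.of_forall fun A => ENNReal.ofReal_ne_top)]
  exact SigmaFinite.withDensity_of_ne_top (.of_forall fun A => ENNReal.inv_ne_top.2 (hpos A))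

open scoped MatrixOrder in
/-- The Gaussian Wishart law has a density with respect to `scatterLebesgue`. -/
theorem gaussianWishart_eq_withDensity (k : ℕ) {S : SqMat m} (hS : S.PosDef) : ∃ C : ℝ≥0∞,
    gaussianWishart k S = C • (scatterLebesgue k m).withDensity
      fun A => ENNReal.ofReal (Real.exp (-(1 / 2) * (S⁻¹ * A).trace)) := by
  obtain ⟨C, hC, h⟩ := pi_pi_gaussianReal k m
  let R : SqMat m := CFC.sqrt S
  have hRR : R * R = S := CFC.sqrt_mul_sqrt_self S hS.posSemidef.nonneg
  have hRt : Rᵀ = R := by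
    have h1 : R.IsHermitian := (Matrix.nonneg_iff_posSemidef.1 (CFC.sqrt_nonneg S)).isHermitian
    rwa [Matrix.IsHermitian, Matrix.conjTranspose_eq_transpose_of_trivial] at h1
  have hSdet : S.det ≠ 0 := hS.det_pos.ne'
  have hRdet : R.det ≠ 0 := fun h0 => hSdet (by rw [← hRR, Matrix.det_mul, h0, mul_zero])
  have hcol : multivariateGaussian (0 : EuclideanSpace ℝ (Fin m)) S =
      (Measure.pi fun _ : Fin m => gaussianReal 0 1).map
        fun x => WithLp.toLp 2 (R *ᵥ x) := by
    rw [multivariateGaussian, ← map_pi_eq_stdGaussian, Measure.map_map (by fun_prop) (by fun_prop)]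
    congr 1
    ext x i
    simp [R]
  have hmeas : Measurable fun x : Fin m → ℝ => (WithLp.toLp 2 (R *ᵥ x) : EuclideanSpace ℝ (Fin m)) :=
    (WithLp.measurable_toLp 2 _).comp
      ((LinearMap.continuous_of_finiteDimensional (Matrix.toLin' R)).measurable)
  have hlaw : gaussianWishart k S =
      ((Measure.pi fun _ : Fin k => Measure.pi fun _ : Fin m => gaussianReal 0 1).map
        (colAct k R)).map scatter := by
    rw [gaussianWishart, hcol]
    have : SigmaFinite ((Measure.pi fun _ : Fin m => gaussianReal 0 1).map
        fun x => (WithLp.toLp 2 (R *ᵥ x) : EuclideanSpace ℝ (Fin m))) := by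
      have := Measure.isProbabilityMeasure_map (μ := Measure.pi fun _ : Fin m => gaussianReal 0 1)
        hmeas.aemeasurable
      infer_instance
    rw [← Measure.pi_map_pi fun _ => hmeas.aemeasurable, Measure.map_map _ _,
      Measure.map_map measurable_scatter (measurable_colAct R)]
    · rfl
    · refine SqMat.measurable_of_entries fun i j => ?_
      simp only [Matrix.mul_apply, Matrix.of_apply, Matrix.transpose_apply]
      fun_prop
    · exact measurable_pi_iff.2 fun l => hmeas.comp (measurable_pi_apply l)
  let f : SqMat m → ℝ≥0∞ := fun A => ENNReal.ofReal (Real.exp (-(1 / 2) * (S⁻¹ * A).trace))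
  have hf : Measurable f :=
    ((SqMat.measurable_trace_mul S⁻¹).const_mul _).exp.ennreal_ofReal
  have hdens : (fun z : Fin k → Fin m → ℝ =>
      ENNReal.ofReal (C * Real.exp (-(1 / 2) * (scatter z).trace))) =
        (((fun A => ENNReal.ofReal C * f A) ∘ scatter) ∘ colAct k R) := by
    ext z
    have h1 : (S⁻¹ * (R * scatter z * R)).trace = (scatter z).trace := by
      have h2 : R * S⁻¹ * R = 1 := by
        have hu : IsUnit R.det := hRdet.isUnit
        rw [← hRR, Matrix.mul_inv_rev, ← Matrix.mul_assoc, Matrix.mul_nonsing_inv _ hu,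
          Matrix.one_mul, Matrix.nonsing_inv_mul _ hu]
      rw [← Matrix.mul_assoc, Matrix.trace_mul_comm, ← Matrix.mul_assoc, ← Matrix.mul_assoc, h2,
        Matrix.one_mul]
    simp only [Function.comp_apply, f]
    rw [scatter_colAct, hRt, h1, ENNReal.ofReal_mul hC.le]
  refine ⟨ENNReal.ofReal |(R.det ^ k)⁻¹| * ENNReal.ofReal C, ?_⟩
  have hCf : Measurable fun A => ENNReal.ofReal C * f A := hf.const_mul _
  rw [hlaw, h, hdens, withDensity_comp_map (measurable_colAct R) _ (hCf.comp measurable_scatter),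
    map_colAct hRdet, withDensity_smul_measure, Measure.map_smul,
    withDensity_comp_map measurable_scatter _ hCf, ← scatterLebesgue, mul_smul]
  congr 1
  exact withDensity_smul _ hf

end Scatter

namespace PosUpper

open SqMat

variable {m k : ℕ}

/-- The left invariant measure that `A = T Tᵀ` makes of `scatterLebesgue`. -/
def haarScatter (k m : ℕ) : Measure (PosUpper m) :=
  ((scatterLebesgue k m).comap gram).withDensity fun T => ENNReal.ofReal (T.val.det ^ k)⁻¹

instance : SigmaFinite (haarScatter k m) := by
  have := measurableEmbedding_gram.sigmaFinite_comap (scatterLebesgue k m)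
  exact SigmaFinite.withDensity_ofReal _

instance : (haarScatter k m).IsMulLeftInvariant := by
  have hm : ∀ g : PosUpper m, Measurable fun A : SqMat m => g.val * A * g.valᵀ := fun g =>
    ((continuous_const.matrix_mul continuous_id).matrix_mul continuous_const).measurable
  refine isMulLeftInvariant_comap_withDensity measurableEmbedding_gram hm
    (fun g T => (gram_mul g T).symm) (fun g A => ?_)
    (χ := fun T => T.val.det ^ k) ((measurable_det.comp measurable_val).pow_const k)
    (fun g => pow_pos g.det_pos k) (fun g h => by rw [det_mul, mul_pow]) fun g => ?_
  · rw [Matrix.mul_assoc, Matrix.mul_assoc (g.val * _), ← Matrix.transpose_mul, inv_val_mul_val,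
      Matrix.transpose_one, Matrix.mul_one, ← Matrix.mul_assoc, inv_val_mul_val, Matrix.one_mul]
  · have hc : (fun A : SqMat m => g.val * A * g.valᵀ) ∘ scatter (k := k) =
        scatter ∘ colAct k g.val := funext fun z => (scatter_colAct g.val z).symm
    rw [scatterLebesgue, Measure.map_map (hm g) measurable_scatter, hc,
      ← Measure.map_map measurable_scatter (measurable_colAct _), map_colAct g.det_pos.ne',
      Measure.map_smul, abs_of_pos (inv_pos.2 (pow_pos g.det_pos k))]

/-- The Gaussian Wishart law in the coordinate `T`. -/
theorem gaussianWishart_eq_map (hmk : m ≤ k) {S : SqMat m} (hS : S.PosDef) : ∃ C : ℝ≥0∞,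
    gaussianWishart k S = C •
      ((haarScatter k m).withDensity fun T => ENNReal.ofReal (weight k S⁻¹ T)).map gram := by
  obtain ⟨C, hC⟩ := gaussianWishart_eq_withDensity k hS
  refine ⟨C, ?_⟩
  have hf : Measurable fun A : SqMat m =>
      ENNReal.ofReal (Real.exp (-(1 / 2) * (S⁻¹ * A).trace)) :=
    ((measurable_trace_mul S⁻¹).const_mul _).exp.ennreal_ofReal
  rw [hC, ← measurableEmbedding_gram.map_comap_withDensity _ hf, haarScatter, ← withDensity_mul]
  · congr 3
    ext T
    have hd := pow_pos T.det_pos k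
    simp only [Function.comp_apply, Pi.mul_apply]
    rw [← ENNReal.ofReal_mul (inv_pos.2 hd).le, weight, Real.rpow_natCast]
    congr 1
    field_simp
  · exact ((measurable_det.comp measurable_val).pow_const k).inv.ennreal_ofReal
  · exact (measurable_weight _ _).ennreal_ofReal
  · have hpd : ∀ᵐ A ∂scatterLebesgue k m, A.PosDef :=
      (ae_map_iff measurable_scatter.aemeasurable measurableSet_posDef).2 (ae_posDef_scatter hmk)
    rw [range_gram]
    exact hpd.mono fun A hA hn => absurd hA hn

end PosUpper

/-! ### Wishart laws in the coordinate of the triangular group -/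

namespace PosUpper

variable {m : ℕ} {n : ℝ} {Ω : SqMat m}

/-- The measure with density `weight n Ω` relative to `haarInv`. -/
def weightMeasure (n : ℝ) (Ω : SqMat m) : Measure (PosUpper m) :=
  (haarInv m).withDensity fun T => ENNReal.ofReal (weight n Ω T)

lemma weightMeasure_univ_ne_zero (n : ℝ) (Ω : SqMat m) :
    weightMeasure n Ω Set.univ ≠ 0 := by
  have hm := (measurable_weight n Ω).ennreal_ofReal
  rw [weightMeasure, Ne, Measure.measure_univ_eq_zero, withDensity_eq_zero_iff hm.aemeasurable]
  intro h
  refine haarInv_ne_zero (m := m) ?_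
  rw [← ae_eq_bot, ← Filter.empty_mem_iff_bot]
  filter_upwards [h] with T hT
  exact absurd hT (by simpa using weight_pos n Ω T)

lemma weightMeasure_univ_ne_top (hn : (m : ℝ) - 1 < n) (hΩ : Ω.PosDef) :
    weightMeasure n Ω Set.univ ≠ ∞ := by
  obtain ⟨V, rfl⟩ := hΩ.exists_posUpper
  obtain ⟨a, -, ha, h⟩ := exists_eq_smul_of_isMulLeftInvariant' (haarInv m) (haarLeft m)
    haarInv_ne_zero haarLeft_ne_zero
  rw [weightMeasure, withDensity_apply _ .univ, Measure.restrict_univ, h, lintegral_smul_measure]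
  exact ENNReal.mul_ne_top ha (lintegral_weight_lt_top hn V).ne

/-- Under either description, the Wishart law `W_m(n, Ω⁻¹)` is the image under `T ↦ T Tᵀ` of the
normalized `weightMeasure n Ω`. -/
theorem eq_map_weightMeasure_of_isWishart (hn : (m : ℝ) - 1 < n) (hΩ : Ω.PosDef)
    {ν : Measure (SqMat m)} (hν : IsWishart n Ω⁻¹ ν) :
    ν = (weightMeasure n Ω Set.univ)⁻¹ • (weightMeasure n Ω).map gram := by
  have hinv : Ω⁻¹⁻¹ = Ω :=
    Matrix.nonsing_inv_nonsing_inv Ω ((Matrix.isUnit_iff_isUnit_det _).1 hΩ.isUnit)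
  have hK0 := weightMeasure_univ_ne_zero n Ω
  have hK1 := weightMeasure_univ_ne_top hn hΩ
  have huniv : (weightMeasure n Ω).map gram Set.univ = weightMeasure n Ω Set.univ := by
    rw [Measure.map_apply measurable_gram .univ, Set.preimage_univ]
  rcases hν with ⟨k, hk, rfl⟩ | rfl
  · have hmk : m ≤ k := by
      have h : (m : ℝ) < (k + 1 : ℕ) := by push_cast; linarith
      exact Nat.lt_succ_iff.1 (by exact_mod_cast h)
    obtain ⟨C, hC⟩ := gaussianWishart_eq_map hmk hΩ.inv
    obtain ⟨b, hb⟩ := exists_eq_smul_of_isMulLeftInvariant (haarScatter k m) (haarInv m)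
      haarInv_ne_zero
    rw [hinv, hk, hb, withDensity_smul_measure, Measure.map_smul, smul_smul] at hC
    -- Both sides are multiples of the same finite measure, and the left-hand side has mass one.
    have hprob : gaussianWishart k Ω⁻¹ Set.univ = 1 := by
      have : IsProbabilityMeasure (gaussianWishart k Ω⁻¹) := by
        refine Measure.isProbabilityMeasure_map (Measurable.aemeasurable ?_)
        refine SqMat.measurable_of_entries fun i j => ?_
        simp only [Matrix.mul_apply, Matrix.of_apply, Matrix.transpose_apply]
        fun_prop
      exact measure_univ
    rw [hC] at hprob ⊢
    rw [← weightMeasure, Measure.smul_apply, huniv, smul_eq_mul] at hprob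
    rw [ENNReal.eq_inv_of_mul_eq_one_left hprob, weightMeasure]
  · obtain ⟨a, ha0, ha1, ha⟩ := exists_eq_smul_of_isMulLeftInvariant' (haarSymm m) (haarInv m)
      haarSymm_ne_zero haarInv_ne_zero
    have hW : wishartUnnormalized n Ω⁻¹ = a • (weightMeasure n Ω).map gram := by
      rw [wishartUnnormalized_eq_map, hinv, ha, withDensity_smul_measure, Measure.map_smul,
        weightMeasure]
    rw [densityWishart, hW, Measure.smul_apply, huniv, smul_eq_mul, smul_smul,
      ENNReal.mul_inv (.inl ha0) (.inl ha1), mul_comm a⁻¹, mul_assoc,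
      ENNReal.inv_mul_cancel ha0 ha1, mul_one]

lemma cholU_gram_inv (T : PosUpper m) : cholU T.gram⁻¹ = T⁻¹.val := by
  rw [gram_inv, cholU_transpose_mul_self]

end PosUpper

end

theorem mainTheorem2 (m : ℕ) (n : ℝ) (hn : (m : ℝ) - 1 < n) (Ω : SqMat m) (hΩ : Ω.PosDef) :
    ∃ c : ℝ, 0 < c ∧
      ∀ {E : Type*} [MeasurableSpace E] (P : Measure E) (B : E → SqMat m) (μ : Measure (SqMat m)),
        IsInverseWishart n Ω μ → HasLaw B μ P →
          (∀ᵐ ω ∂P, IsUpperCholesky (B ω) (cholU (B ω))) ∧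
          HasLaw (fun ω => cholU (B ω))
            ((upperLebesgue m).withDensity fun U =>
              ENNReal.ofReal (c * cholInvWishartKernel n (cholU Ω) U)) P := by
  have hK0 := PosUpper.weightMeasure_univ_ne_zero n Ω
  have hK1 := PosUpper.weightMeasure_univ_ne_top hn hΩ
  refine ⟨((PosUpper.weightMeasure n Ω Set.univ)⁻¹).toReal,
    ENNReal.toReal_pos (ENNReal.inv_ne_zero.2 hK1) (ENNReal.inv_ne_top.2 hK0), ?_⟩
  intro E _ P B μ hμ hB
  obtain ⟨ν, hν, rfl⟩ := hμ
  have hmap : ν.map (fun A => A⁻¹) =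
      (PosUpper.weightMeasure n Ω Set.univ)⁻¹ • (PosUpper.weightMeasure n Ω).map fun T => T.gram⁻¹ := by
    rw [PosUpper.eq_map_weightMeasure_of_isWishart hn hΩ hν, Measure.map_smul,
      Measure.map_map SqMat.measurable_inv PosUpper.measurable_gram]
    rfl
  rw [hmap] at hB
  have hgi : Measurable fun T : PosUpper m => T.gram⁻¹ :=
    SqMat.measurable_inv.comp PosUpper.measurable_gram
  constructor
  · have hpd : ∀ᵐ X ∂P.map B, X.PosDef := by
      rw [hB.map_eq]
      refine Measure.ae_smul_measure ?_ _
      rw [ae_map_iff hgi.aemeasurable measurableSet_posDef]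
      exact .of_forall fun T => T.gram_posDef.inv
    exact (ae_of_ae_map hB.aemeasurable hpd).mono fun ω h => h.isUpperCholesky_cholU
  · refine ⟨measurable_cholU.comp_aemeasurable hB.aemeasurable, ?_⟩
    obtain ⟨V, rfl⟩ := hΩ.exists_posUpper
    have hcomp : cholU ∘ (fun T : PosUpper m => T.gram⁻¹) = fun T => T⁻¹.val :=
      funext PosUpper.cholU_gram_inv
    have hk : Measurable fun U : SqMat m =>
        ENNReal.ofReal (cholInvWishartKernel n V.val U) :=
      (measurable_cholInvWishartKernel n V.val).ennreal_ofReal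
    calc P.map (fun ω => cholU (B ω)) = (P.map B).map cholU :=
          (AEMeasurable.map_map_of_aemeasurable measurable_cholU.aemeasurable hB.aemeasurable).symm
      _ = (PosUpper.weightMeasure n (V.valᵀ * V.val) Set.univ)⁻¹ • (upperLebesgue m).withDensity
            fun U => ENNReal.ofReal (cholInvWishartKernel n V.val U) := by
          rw [hB.map_eq, Measure.map_smul, Measure.map_map measurable_cholU hgi, hcomp,
            PosUpper.upperLebesgue_withDensity_eq_map, PosUpper.weightMeasure]
      _ = _ := by
          rw [← withDensity_smul _ hk, PosUpper.cholU_transpose_mul_self]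
          congr 1
          ext U
          rw [ENNReal.ofReal_mul ENNReal.toReal_nonneg,
            ENNReal.ofReal_toReal (ENNReal.inv_ne_top.2 hK0)]
          rfl
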